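/- All matroids are finite. A matroid $M$ is *base-orderable* if for any two bases $B_1,B_2$ there is a bijection $\sigma:B_1\to B_2$ such that for every $x\in B_1$ both $(B_1-\{x\})\cup\{\sigma(x)\}$ and $(B_2-\{\sigma(x)\})\cup\{x\}$ are bases. It is *strongly base-orderable* (resp. *$k$-base-orderable*, for an integer $k\ge 1$) if for any two bases $B_1,B_2$ there is a bijection $\sigma:B_1\to B_2$ such that for every $X\subseteq B_1$ (resp. every $X\subseteq B_1$ with $|X|\le k$) both $(B_1-X)\cup\sigma(X)$ and $(B_2-\sigma(X))\cup X$ are bases. These classes are denoted $\mathcal{BO}$, $\mathcal{SBO}$ and $k$-$\mathcal{BO}$. A matroid is *transversal* if its independent sets are the partial transversals of a finite family of subsets of its ground set, *cotransversal* if its dual is transversal, and a *gammoid* if it is (isomorphic to) a minor of a transversal matroid. An *excluded minor* for a class of matroids is a matroid that is not in the class while all of its proper minors are. A *cyclic flat* is a flat that is a (possibly empty) union of circuits. **Theorem.** Let $r\ge 3$ be an integer and let $\alpha=(A,B,C,D,E,F)$ be a $6$-tuple of pairwise disjoint nonempty sets with $$|A\cup B\cup C|=|D\cup E\cup F|=r\qquad\text{and}\qquad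 |A\cup B\cup D\cup E|=r+1.$$ There is a unique matroid $M_\alpha$ of rank $r$ with ground set $S=A\cup B\cup C\cup D\cup E\cup F$ whose cyclic flats are exactly $\varnothing$, $S$, $C\cup B\cup E$, $C\cup A\cup D$, $F\cup E\cup A$ and $F\cup D\cup B$, with $$r(C\cup B\cup E)=|C|+|B|,\quad r(C\cup A\cup D)=|C|+|A|,\quad r(F\cup E\cup A)=|F|+|E|,\quad r(F\cup D\cup B)=|F|+|D|.$$ It has the following properties: 1. $M_\alpha$ is not base-orderable; 2. each single-element contraction of $M_\alpha$ is transversal; 3. each single-element deletion of $M_\alpha$ is cotransversal; 4. $M_\alpha$ is an excluded minor for each of the following classes of matroids: gammoids, $\mathcal{BO}$, $\mathcal{SBO}$, and $k$-$\mathcal{BO}$ for every $k\ge 1$. -/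

import Mathlib

universe u

namespace Matroid

/-- A set is cyclic if it is a (possibly empty) union of circuits. -/
def IsCyclicSet {α : Type u} (M : Matroid α) (X : Set α) : Prop :=
  ∃ 𝒞 : Set (Set α), (∀ K ∈ 𝒞, M.IsCircuit K) ∧ X = ⋃₀ 𝒞

/-- A cyclic flat is a flat that is a union of circuits. -/
def IsCyclicFlat {α : Type u} (M : Matroid α) (X : Set α) : Prop :=
  M.IsFlat X ∧ M.IsCyclicSet X

/-- Base-orderability: any two bases `B₁`, `B₂` admit a bijection `σ : B₁ → B₂` such that, for every
`x ∈ B₁`, both `(B₁ - x) ∪ σ(x)` and `(B₂ - σ(x)) ∪ x` are bases. -/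
def IsBaseOrderable {α : Type u} (M : Matroid α) : Prop :=
  ∀ B₁ B₂ : Set α, M.IsBase B₁ → M.IsBase B₂ →
    ∃ σ : α → α, Set.BijOn σ B₁ B₂ ∧
      ∀ x ∈ B₁, M.IsBase ((B₁ \ {x}) ∪ {σ x}) ∧ M.IsBase ((B₂ \ {σ x}) ∪ {x})

/-- Strong base-orderability: the exchange is possible for all subsets `X` of `B₁`
simultaneously. -/
def IsStronglyBaseOrderable {α : Type u} (M : Matroid α) : Prop :=
  ∀ B₁ B₂ : Set α, M.IsBase B₁ → M.IsBase B₂ →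
    ∃ σ : α → α, Set.BijOn σ B₁ B₂ ∧
      ∀ X ⊆ B₁, M.IsBase ((B₁ \ X) ∪ σ '' X) ∧ M.IsBase ((B₂ \ σ '' X) ∪ X)

/-- `k`-base-orderability: the exchange is possible for all subsets `X` of `B₁`
with `|X| ≤ k`. -/
def IsKBaseOrderable {α : Type u} (k : ℕ) (M : Matroid α) : Prop :=
  ∀ B₁ B₂ : Set α, M.IsBase B₁ → M.IsBase B₂ →
    ∃ σ : α → α, Set.BijOn σ B₁ B₂ ∧
      ∀ X ⊆ B₁, X.encard ≤ k →
        M.IsBase ((B₁ \ X) ∪ σ '' X) ∧ M.IsBase ((B₂ \ σ '' X) ∪ X)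

/-- A matroid on a finite ground set is transversal if its independent sets are the partial
transversals of some finite family `(S₁, …, Sₙ)` of sets. -/
def IsTransversal {α : Type u} (M : Matroid α) : Prop :=
  M.E.Finite ∧ ∃ (n : ℕ) (S : Fin n → Set α), (∀ i, S i ⊆ M.E) ∧
    ∀ I : Set α, M.Indep I ↔
      I ⊆ M.E ∧ ∃ φ : I → Fin n, Function.Injective φ ∧ ∀ x : I, (x : α) ∈ S (φ x)

/-- A matroid is cotransversal if its dual is transversal. -/
def IsCotransversal {α : Type u} (M : Matroid α) : Prop :=
  M✶.IsTransversal

/-- A gammoid is (up to isomorphism) a minor of a transversal matroid. The transversal matroid may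
need more elements than the ambient type `α` offers, so it lives on another type `β`,
and `M.map f hf` is the isomorphic copy of `M` along a map `f` that is injective
on the ground set of `M`. -/
def IsGammoid {α : Type u} (M : Matroid α) : Prop :=
  ∃ (β : Type u) (N : Matroid β) (f : α → β) (hf : Set.InjOn f M.E),
    N.IsTransversal ∧ M.map f hf ≤m N

/-- `M` is an excluded minor for the class `P`: it is not in the class, but all its
proper minors are. -/
def IsExcludedMinor {α : Type u} (P : Matroid α → Prop) (M : Matroid α) : Prop :=
  ¬ P M ∧ ∀ N : Matroid α, N <m M → P N

/-- `M` is the matroid `M_α` of the tuple `(A, B, C, D, E, F)`: its ground set is the union of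
the six sets, its rank is `|A ∪ B ∪ C|`, and its nonempty proper cyclic flats are the four sets
`C ∪ B ∪ E`, `C ∪ A ∪ D`, `F ∪ E ∪ A`, `F ∪ D ∪ B`, with the ranks given below; the empty set and
the ground set are cyclic flats too. -/
structure IsMAlpha {α : Type u} (A B C D E F : Set α) (M : Matroid α) : Prop where
  ground_eq : M.E = A ∪ B ∪ C ∪ D ∪ E ∪ F
  isCyclicFlat_iff : ∀ X : Set α, M.IsCyclicFlat X ↔
    X = ∅ ∨ X = C ∪ B ∪ E ∨ X = C ∪ A ∪ D ∨ X = F ∪ E ∪ A ∨ X = F ∪ D ∪ B ∨ X = M.E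
  eRank_eq : M.eRank = (A ∪ B ∪ C).encard
  eRk_CBE : M.eRk (C ∪ B ∪ E) = C.encard + B.encard
  eRk_CAD : M.eRk (C ∪ A ∪ D) = C.encard + A.encard
  eRk_FEA : M.eRk (F ∪ E ∪ A) = F.encard + E.encard
  eRk_FDB : M.eRk (F ∪ D ∪ B) = F.encard + D.encard

end Matroid

/-!
# A family of excluded minors for gammoids and for base-orderable matroids

The prescribed cyclic flats `Z i` and their ranks `k i` determine the matroid `M`: as every
dependent set violates the rank of a cyclic flat (`indep_iff_forall_isCyclicFlat`), a subset `I` of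
the ground set is independent if and only if `|I| ≤ r` and `|I ∩ Z i| ≤ k i` for `i = 1, …, 4`.
Conversely, the sets so described are the independent sets of a matroid whenever
`r + |Z i ∩ Z j| ≤ k i + k j` for `i ≠ j`, because then a set of size less than `r` attains at most
one of the bounds. The cyclic flats of this elementary split matroid are `∅`, the `Z i` and the
ground set (`IsElementarySplit.isCyclicFlat_iff`). For the six-tuple `(A, …, F)` the pairwise
intersections of the `Z i` are the six sets, and the inequality can be checked for each pair.

The matroid is not base-orderable. An exchange bijection between the bases `A ∪ B ∪ C` and
`D ∪ E ∪ F` cannot map an element of `A ∪ B` to an element of `D ∪ E`, as one of the two exchanged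
sets would then contain too many elements of some `Z i`. So it maps `A ∪ B` injectively into `F`,
but the conditions on the sizes give `|A| + |B| = |F| + 1`.

The sum of the differences `r - k i` is `r + 1`, and each element lies outside exactly two of the
`Z i`. Contracting an element `x` lowers `r` by one and `r - k i` by one for those two `i`, so that
the sum of the differences becomes the rank. Then the complements of the `Z i`, each repeated
`r - k i` times, have the right number of members for a transversal presentation, and Hall's
theorem shows that they form one (`IsElementarySplit.isTransversal`). The dual of `M` is an
elementary split matroid on the complements of the `Z i` with the same numerical properties, so its
contractions are transversal too, which makes the deletions of `M` cotransversal.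

Every proper minor of `M` is a minor of a single-element contraction or deletion, hence a gammoid:
a cotransversal matroid is a contraction of a transversal matroid on a larger ground set
(`IsCotransversal.exists_isMinor_isTransversal`). Gammoids are strongly base-orderable, since
transversal matroids are (match the elements of the two bases that are assigned to the same member
of the family) and since the property passes to minors. The classes in question therefore all
contain the gammoids and are contained in the class of base-orderable matroids: `M` belongs to none
of them, and all its proper minors to each.
-/

namespace Matroid

/-! ### Transversal matroids are strongly base-orderable -/

section Matching

variable {α : Type u} {M : Matroid α}

/-- The definition of a transversal matroid with matchings that are total functions, so that they
can be updated and glued. -/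
lemma IsTransversal.exists_indep_iff_injOn (hM : M.IsTransversal) :
    ∃ W : ℕ → Set α, ∀ I, M.Indep I ↔
      I ⊆ M.E ∧ ∃ φ : α → ℕ, Set.InjOn φ I ∧ ∀ x ∈ I, x ∈ W (φ x) := by
  classical
  obtain ⟨-, n, S, -, hS⟩ := hM
  refine ⟨fun j ↦ {x | ∃ h : j < n, x ∈ S ⟨j, h⟩}, fun I ↦ ?_⟩
  rw [hS]
  refine and_congr_right fun _ ↦ ⟨?_, ?_⟩
  · rintro ⟨φ, hφ, hφS⟩
    refine ⟨fun x ↦ if h : x ∈ I then φ ⟨x, h⟩ else 0, fun x hx y hy hxy ↦ ?_, fun x hx ↦ ?_⟩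
    · simp only [hx, hy, dite_true] at hxy
      simpa using hφ (Fin.ext hxy)
    · simpa [hx] using hφS ⟨x, hx⟩
  · rintro ⟨φ, hφ, hφW⟩
    choose h hW using hφW
    exact ⟨fun x ↦ ⟨φ x, h x x.2⟩, fun x y hxy ↦ Subtype.ext
      (hφ x.2 y.2 (by simpa using hxy)), fun x ↦ hW x x.2⟩

/-- Any two bases of a transversal matroid can be matched to the same set of indices. -/
lemma exists_matching_image_eq [M.Finite] {W : ℕ → Set α} (hW : ∀ I, M.Indep I ↔
      I ⊆ M.E ∧ ∃ φ : α → ℕ, Set.InjOn φ I ∧ ∀ x ∈ I, x ∈ W (φ x))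
    {B₁ B₂ : Set α} (hB₁ : M.IsBase B₁) (hB₂ : M.IsBase B₂) :
    ∃ φ₁ φ₂ : α → ℕ, Set.InjOn φ₁ B₁ ∧ (∀ x ∈ B₁, x ∈ W (φ₁ x)) ∧
      Set.InjOn φ₂ B₂ ∧ (∀ x ∈ B₂, x ∈ W (φ₂ x)) ∧ φ₁ '' B₁ = φ₂ '' B₂ := by
  classical
  obtain ⟨-, φ₁, hφ₁, hφ₁W⟩ := (hW B₁).1 hB₁.indep
  -- Among the matchings of `B₂`, `φ₂` disagrees with `φ₁` in as few elements of `B₁ ∩ B₂` as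
  -- possible. If `φ₁ x` is not used by `φ₂`, sending `x` to it reduces the disagreement or
  -- enlarges `B₂`.
  obtain ⟨φ₂, ⟨hφ₂, hφ₂W⟩, hmin⟩ := exists_minimalFor_of_wellFoundedLT
    (fun φ : α → ℕ ↦ Set.InjOn φ B₂ ∧ ∀ x ∈ B₂, x ∈ W (φ x))
    (fun φ ↦ {x ∈ B₁ ∩ B₂ | φ₁ x ≠ φ x}.ncard) ((hW B₂).1 hB₂.indep).2
  have hfin₁ : B₁.Finite := M.set_finite B₁ hB₁.subset_ground
  have hfin₂ : B₂.Finite := M.set_finite B₂ hB₂.subset_ground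
  refine ⟨φ₁, φ₂, hφ₁, hφ₁W, hφ₂, hφ₂W, Set.eq_of_subset_of_ncard_le ?_ ?_ (hfin₂.image _)⟩
  · rintro _ ⟨x, hx, rfl⟩
    by_contra hxφ
    let ψ := Function.update φ₂ x (φ₁ x)
    have hne {y : α} (hy : y ∈ B₂) : φ₂ y ≠ φ₁ x := fun h ↦ hxφ ⟨y, hy, h⟩
    have hψ : Set.InjOn ψ (insert x B₂) := by
      intro y hy z hz hyz
      simp only [ψ, Function.update_apply] at hyz
      grind [Set.InjOn]
    have hψW : ∀ y ∈ insert x B₂, y ∈ W (ψ y) := by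
      intro y hy
      simp only [ψ, Function.update_apply]
      grind
    by_cases hx₂ : x ∈ B₂
    · rw [Set.insert_eq_of_mem hx₂] at hψ hψW
      have hlt : {y ∈ B₁ ∩ B₂ | φ₁ y ≠ ψ y}.ncard < {y ∈ B₁ ∩ B₂ | φ₁ y ≠ φ₂ y}.ncard := by
        refine Set.ncard_lt_ncard ⟨?_, fun h ↦ ?_⟩ ((hfin₁.inter_of_left _).sep _)
        · rintro y ⟨hy, hyψ⟩
          refine ⟨hy, ?_⟩
          simp only [ψ, Function.update_apply] at hyψ
          grind
        · have := (h ⟨⟨hx, hx₂⟩, (hne hx₂).symm⟩ : x ∈ {y ∈ B₁ ∩ B₂ | φ₁ y ≠ ψ y}).2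
          simp [ψ] at this
      exact (hmin ⟨hψ, hψW⟩ hlt.le).not_gt hlt
    · have : M.Indep (insert x B₂) := (hW _).2
        ⟨Set.insert_subset (hB₁.subset_ground hx) hB₂.subset_ground, ψ, hψ, hψW⟩
      rw [hB₂.eq_of_subset_indep this (Set.subset_insert _ _)] at hx₂
      simp at hx₂
  · rw [hφ₁.ncard_image, hφ₂.ncard_image, hB₁.ncard_eq_ncard_of_isBase hB₂]

/-- `σ` is a bijection from `B₁` to `B₂` along which every exchange leaves two independent sets.
Unlike for a strong base exchange, the sets need not keep their size: `σ` may move elements of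
`B₁ ∩ B₂`, so that the unions may fail to be disjoint. -/
def IsExchange (M : Matroid α) (B₁ B₂ : Set α) (σ : α → α) : Prop :=
  Set.BijOn σ B₁ B₂ ∧ ∀ X ⊆ B₁,
    M.Indep ((B₁ \ X) ∪ σ '' X) ∧ M.Indep ((B₂ \ σ '' X) ∪ X)

/-- If `σ` maps `x` to an element of `B₁`, the bijection that fixes `σ x` and maps `x` to `σ (σ x)`
is again an exchange: it produces only pairs of sets that `σ` produces too. -/
lemma IsExchange.shortcut [DecidableEq α] {B₁ B₂ : Set α} {σ : α → α} (h : M.IsExchange B₁ B₂ σ)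
    {x : α} (hx : x ∈ B₁) (hσx : σ x ∈ B₁) :
    M.IsExchange B₁ B₂ (σ ∘ Equiv.swap x (σ x)) := by
  obtain ⟨hσ, hX⟩ := h
  have hinj {a b : α} (ha : a ∈ B₁) (hb : b ∈ B₁) (hab : σ a = σ b) : a = b :=
    hσ.injOn ha hb hab
  have hyB₂ : σ x ∈ B₂ := hσ.mapsTo hx
  have hswap : Set.BijOn (Equiv.swap x (σ x)) B₁ B₁ := by
    have hmaps : Set.MapsTo (Equiv.swap x (σ x)) B₁ B₁ := by
      intro a ha
      rw [Equiv.swap_apply_def]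
      split_ifs <;> assumption
    exact ⟨hmaps, (Equiv.injective _).injOn, fun a ha ↦ ⟨_, hmaps ha, by simp⟩⟩
  refine ⟨hσ.comp hswap, fun X hXB ↦ ?_⟩
  have himg {Y : Set α} (hY : ∀ a, a ∈ Y ↔ Equiv.swap x (σ x) a ∈ X) :
      (σ ∘ Equiv.swap x (σ x)) '' X = σ '' Y := by
    rw [Set.image_comp, Equiv.image_eq_preimage_symm, Equiv.symm_swap]
    congr 1
    ext a
    exact (hY a).symm
  have key : ∃ Y ⊆ B₁, (B₁ \ X) ∪ (σ ∘ Equiv.swap x (σ x)) '' X = (B₁ \ Y) ∪ σ '' Y ∧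
      (B₂ \ (σ ∘ Equiv.swap x (σ x)) '' X) ∪ X = (B₂ \ σ '' Y) ∪ Y := by
    by_cases hxX : x ∈ X <;> by_cases hyX : σ x ∈ X
    · rw [himg (Y := X) (by intro a; rw [Equiv.swap_apply_def]; grind)]
      exact ⟨X, hXB, rfl, rfl⟩
    · rw [himg (Y := insert (σ x) (X \ {x})) (by intro a; rw [Equiv.swap_apply_def]; grind)]
      refine ⟨insert (σ x) X, Set.insert_subset hσx hXB, ?_⟩
      obtain ⟨P, hxP, rfl⟩ : ∃ P, x ∉ P ∧ insert x P = X := ⟨X \ {x}, by simp, by simp [hxX]⟩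
      have hyw : σ x ≠ σ (σ x) := fun h ↦ hyX (by rw [← hinj hx hσx h]; simp)
      have hyP : σ x ∉ σ '' P := by
        rintro ⟨a, ha, hax⟩
        exact hxP (by rwa [← hinj (hXB (by simp [ha])) hx hax])
      rw [Set.insert_sdiff_of_mem _ (by simp), Set.sdiff_singleton_eq_self hxP,
        Set.image_insert_eq, Set.image_insert_eq, Set.image_insert_eq]
      generalize σ '' P = Q at hyP
      constructor
      · ext z; grind
      · ext z; grind
    · rw [himg (Y := insert x (X \ {σ x})) (by intro a; rw [Equiv.swap_apply_def]; grind)]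
      refine ⟨X \ {σ x}, Set.sdiff_subset.trans hXB, ?_⟩
      have hyP : σ x ∉ σ '' (X \ {σ x}) := by
        rintro ⟨a, ha, hax⟩
        exact hxX (by rw [← hinj (hXB ha.1) hx hax]; exact ha.1)
      rw [Set.image_insert_eq]
      generalize σ '' (X \ {σ x}) = Q at hyP
      constructor
      · ext z; grind
      · ext z; grind
    · rw [himg (Y := X) (by intro a; rw [Equiv.swap_apply_def]; grind)]
      exact ⟨X, hXB, rfl, rfl⟩
  obtain ⟨Y, hY, h1, h2⟩ := key
  rw [h1, h2]
  exact hX Y hY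

/-- Repeated shortcuts lead to an exchange that fixes `B₁ ∩ B₂` pointwise. -/
lemma IsExchange.exists_fix {B₁ B₂ : Set α} (hB₁ : B₁.Finite) {σ : α → α}
    (h : M.IsExchange B₁ B₂ σ) :
    ∃ τ, M.IsExchange B₁ B₂ τ ∧ ∀ x ∈ B₁, τ x ∈ B₁ → τ x = x := by
  classical
  obtain ⟨τ, hτ, hmin⟩ := exists_minimalFor_of_wellFoundedLT (M.IsExchange B₁ B₂)
    (fun τ ↦ {x ∈ B₁ | τ x ≠ x}.ncard) ⟨σ, h⟩
  refine ⟨τ, hτ, fun x hx hτx ↦ ?_⟩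
  by_contra hne
  have hlt : {a ∈ B₁ | (τ ∘ Equiv.swap x (τ x)) a ≠ a}.ncard < {a ∈ B₁ | τ a ≠ a}.ncard := by
    refine Set.ncard_lt_ncard ⟨?_, fun h ↦ ?_⟩ (hB₁.sep _)
    · rintro a ⟨ha, hane⟩
      refine ⟨ha, ?_⟩
      rw [Function.comp_apply, Equiv.swap_apply_def] at hane
      grind
    · have := (h ⟨hτx, fun h' ↦ hne (hτ.1.injOn hτx hx h')⟩ :
        τ x ∈ {a ∈ B₁ | (τ ∘ Equiv.swap x (τ x)) a ≠ a}).2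
      simp at this
  exact (hmin (hτ.shortcut hx hτx) hlt.le).not_gt hlt

/-- The bijection matches the elements of the two bases that are assigned the same index. -/
theorem IsTransversal.isStronglyBaseOrderable (hM : M.IsTransversal) :
    M.IsStronglyBaseOrderable := by
  classical
  intro B₁ B₂ hB₁ hB₂
  have : M.Finite := ⟨hM.1⟩
  have hfin₁ : B₁.Finite := M.set_finite B₁ hB₁.subset_ground
  have hfin₂ : B₂.Finite := M.set_finite B₂ hB₂.subset_ground
  obtain ⟨W, hW⟩ := hM.exists_indep_iff_injOn
  obtain ⟨φ₁, φ₂, hφ₁, hφ₁W, hφ₂, hφ₂W, himg⟩ := exists_matching_image_eq hW hB₁ hB₂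
  have hex : ∀ x ∈ B₁, ∃ y ∈ B₂, φ₂ y = φ₁ x := fun x hx ↦ himg.le ⟨x, hx, rfl⟩
  choose! σ hσB hσ using hex
  have hσbij : Set.BijOn σ B₁ B₂ := by
    refine ⟨hσB, fun x hx y hy hxy ↦ hφ₁ hx hy ?_, fun y hy ↦ ?_⟩
    · rw [← hσ x hx, ← hσ y hy, hxy]
    · obtain ⟨x, hx, hxy⟩ := himg.ge ⟨y, hy, rfl⟩
      exact ⟨x, hx, hφ₂ (hσB x hx) hy ((hσ x hx).trans hxy)⟩
  have hσex : M.IsExchange B₁ B₂ σ := by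
    refine ⟨hσbij, fun X hX ↦ ⟨(hW _).2 ⟨?_, fun e ↦ if e ∈ B₁ \ X then φ₁ e else φ₂ e, ?_, ?_⟩,
      (hW _).2 ⟨?_, fun e ↦ if e ∈ X then φ₁ e else φ₂ e, ?_, ?_⟩⟩⟩
    · exact Set.union_subset (Set.sdiff_subset.trans hB₁.subset_ground)
        ((hσbij.mapsTo.mono_left hX).image_subset.trans hB₂.subset_ground)
    · have key {a b : α} (ha : a ∈ B₁ \ X) (hb : b ∈ σ '' X) : φ₁ a ≠ φ₂ b := by
        obtain ⟨x, hx, rfl⟩ := hb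
        rw [hσ x (hX hx)]
        exact fun h ↦ ha.2 (by rwa [hφ₁ ha.1 (hX hx) h])
      have hsub : σ '' X ⊆ B₂ := (hσbij.mapsTo.mono_left hX).image_subset
      intro a ha b hb hab
      by_cases ha' : a ∈ B₁ \ X <;> by_cases hb' : b ∈ B₁ \ X <;>
        simp only [ha', hb', if_true, if_false] at hab
      · exact hφ₁ ha'.1 hb'.1 hab
      · exact absurd hab (key ha' (hb.resolve_left hb'))
      · exact absurd hab.symm (key hb' (ha.resolve_left ha'))
      · exact hφ₂ (hsub (ha.resolve_left ha')) (hsub (hb.resolve_left hb')) hab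
    · intro a ha
      by_cases ha' : a ∈ B₁ \ X <;> simp only [ha', if_true, if_false]
      · exact hφ₁W a ha'.1
      · obtain ⟨x, hx, rfl⟩ := ha.resolve_left ha'
        exact hφ₂W _ (hσB x (hX hx))
    · exact Set.union_subset (Set.sdiff_subset.trans hB₂.subset_ground)
        (hX.trans hB₁.subset_ground)
    · have key {a b : α} (ha : a ∈ X) (hb : b ∈ B₂ \ σ '' X) : φ₁ a ≠ φ₂ b := by
        rw [← hσ a (hX ha)]
        exact fun h ↦ hb.2 ⟨a, ha, hφ₂ (hσB a (hX ha)) hb.1 h⟩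
      intro a ha b hb hab
      by_cases ha' : a ∈ X <;> by_cases hb' : b ∈ X <;>
        simp only [ha', hb', if_true, if_false] at hab
      · exact hφ₁ (hX ha') (hX hb') hab
      · exact absurd hab (key ha' (hb.resolve_right hb'))
      · exact absurd hab.symm (key hb' (ha.resolve_right ha'))
      · exact hφ₂ (ha.resolve_right ha').1 (hb.resolve_right hb').1 hab
    · intro a ha
      by_cases ha' : a ∈ X <;> simp only [ha', if_true, if_false]
      · exact hφ₁W a (hX ha')
      · exact hφ₂W a (ha.resolve_right ha').1
  obtain ⟨τ, ⟨hτ, hτX⟩, hfix⟩ := hσex.exists_fix hfin₁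
  have hbase {I : Set α} (hI : M.Indep I) (hc : I.encard = B₁.encard) : M.IsBase I := by
    obtain ⟨B, hB, hIB⟩ := hI.exists_isBase_superset
    have := (M.set_finite I hI.subset_ground).eq_of_subset_of_encard_le hIB
      (by rw [hc, hB.encard_eq_encard_of_isBase hB₁])
    rwa [this]
  refine ⟨τ, hτ, fun X hX ↦ ⟨hbase (hτX X hX).1 ?_, hbase (hτX X hX).2 ?_⟩⟩
  · rw [Set.encard_union_eq, (hτ.injOn.mono hX).encard_image,
      Set.encard_sdiff_add_encard_of_subset hX]
    rw [Set.disjoint_left]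
    rintro _ ha ⟨x, hx, rfl⟩
    exact ha.2 (by rwa [hfix x (hX hx) ha.1])
  · rw [Set.encard_union_eq, ← (hτ.injOn.mono hX).encard_image,
      Set.encard_sdiff_add_encard_of_subset (hτ.mapsTo.mono_left hX).image_subset,
      hB₁.encard_eq_encard_of_isBase hB₂]
    rw [Set.disjoint_left]
    intro a ha haX
    obtain ⟨x, hx, rfl⟩ := hτ.surjOn ha.1
    have hxx := hfix x hx (hX haX)
    exact ha.2 ⟨x, hxx ▸ haX, rfl⟩

end Matching

/-! ### Gammoids are strongly base-orderable -/

section BaseOrderable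

variable {α : Type u} {M : Matroid α}

lemma IsStronglyBaseOrderable.isKBaseOrderable (h : M.IsStronglyBaseOrderable) (k : ℕ) :
    M.IsKBaseOrderable k := by
  intro B₁ B₂ hB₁ hB₂
  obtain ⟨σ, hσ, hσX⟩ := h B₁ B₂ hB₁ hB₂
  exact ⟨σ, hσ, fun X hX _ ↦ hσX X hX⟩

lemma IsKBaseOrderable.isBaseOrderable {k : ℕ} (hk : 1 ≤ k) (h : M.IsKBaseOrderable k) :
    M.IsBaseOrderable := by
  intro B₁ B₂ hB₁ hB₂
  obtain ⟨σ, hσ, hσX⟩ := h B₁ B₂ hB₁ hB₂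
  refine ⟨σ, hσ, fun x hx ↦ ?_⟩
  simpa using hσX {x} (by simpa using hx) (by simpa using hk)

lemma IsStronglyBaseOrderable.isBaseOrderable (h : M.IsStronglyBaseOrderable) :
    M.IsBaseOrderable :=
  (h.isKBaseOrderable 1).isBaseOrderable le_rfl

/-- The bases of `M ＼ D` are the sets that become bases of `M` when a fixed set `J` is added. One
may take `J = B₁ \ B₀` for any base `B₀` of `M ＼ D` and any base `B₁ ⊇ B₀` of `M`. -/
lemma exists_delete_isBase_iff (M : Matroid α) [M.Finite] (D : Set α) :
    ∃ J ⊆ M.E, Disjoint J (M ＼ D).E ∧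
      ∀ B ⊆ (M ＼ D).E, ((M ＼ D).IsBase B ↔ M.IsBase (B ∪ J)) := by
  obtain ⟨B₀, hB₀⟩ := (M ＼ D).exists_isBase
  obtain ⟨B₁, hB₁, hB₀₁⟩ := hB₀.indep.of_delete.exists_isBase_superset
  have hmax {B B' : Set α} (hB : (M ＼ D).IsBase B) (hB' : M.IsBase B') (hBB' : B ⊆ B') :
      B' ∩ (M ＼ D).E ⊆ B := by
    have h1 : (M ＼ D).Indep (B' ∩ (M ＼ D).E) := by
      rw [delete_indep_iff]
      exact ⟨hB'.indep.subset Set.inter_subset_left,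
        Set.disjoint_left.2 fun x hx ↦ hx.2.2⟩
    exact (hB.eq_of_subset_indep h1 (Set.subset_inter hBB' hB.subset_ground)).ge
  have hdisj : Disjoint (B₁ \ B₀) (M ＼ D).E :=
    Set.disjoint_left.2 fun x hx hxE ↦ hx.2 (hmax hB₀ hB₁ hB₀₁ ⟨hx.1, hxE⟩)
  have hunion {B : Set α} (hB : (M ＼ D).IsBase B) : M.IsBase (B ∪ B₁ \ B₀) := by
    obtain ⟨B', hB', hBB', hB'₁⟩ := hB.indep.of_delete.exists_isBase_subset_union_isBase hB₁
    have hsub : B' ⊆ B ∪ B₁ \ B₀ := by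
      intro x hx
      by_cases hxB₀ : x ∈ B₀
      · exact .inl (hmax hB hB' hBB' ⟨hx, hB₀.subset_ground hxB₀⟩)
      · exact (hB'₁ hx).imp id fun h ↦ ⟨h, hxB₀⟩
    have hcard : (B ∪ B₁ \ B₀).encard ≤ B'.encard := by
      refine (Set.encard_union_le _ _).trans ?_
      rw [hB.encard_eq_encard_of_isBase hB₀, add_comm, Set.encard_sdiff_add_encard_of_subset hB₀₁,
        hB'.encard_eq_encard_of_isBase hB₁]
    have := (M.set_finite B' hB'.subset_ground).eq_of_subset_of_encard_le hsub hcard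
    rwa [← this]
  refine ⟨B₁ \ B₀, Set.sdiff_subset.trans hB₁.subset_ground, hdisj,
    fun B hB ↦ ⟨hunion, fun h ↦ ?_⟩⟩
  have hBi : (M ＼ D).Indep B := by
    rw [delete_indep_iff]
    exact ⟨h.indep.subset Set.subset_union_left, Set.disjoint_left.2 fun x hx ↦ (hB hx).2⟩
  obtain ⟨B', hB', hBB'⟩ := hBi.exists_isBase_superset
  have heq := h.eq_of_subset_isBase (hunion hB') (Set.union_subset_union_left _ hBB')
  suffices B = B' by rwa [this]
  refine hBB'.antisymm fun x hx ↦ (heq.ge (.inl hx)).resolve_right fun hxJ ↦ ?_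
  exact Set.disjoint_left.1 hdisj hxJ (hB'.subset_ground hx)

lemma exists_contract_isBase_iff (M : Matroid α) [M.Finite] (C : Set α) :
    ∃ I, Disjoint I (M ／ C).E ∧
      ∀ B ⊆ (M ／ C).E, ((M ／ C).IsBase B ↔ M.IsBase (B ∪ I)) := by
  obtain ⟨J, hJ, hdisj, hiff⟩ := M✶.exists_delete_isBase_iff C
  rw [dual_ground] at hJ
  have hdisj' : J ⊆ C := by
    intro x hx
    by_contra hxC
    exact Set.disjoint_left.1 hdisj hx ⟨hJ hx, hxC⟩
  refine ⟨(C ∩ M.E) \ J, Set.disjoint_left.2 fun x hx hxE ↦ hxE.2 hx.1.1, fun B hB ↦ ?_⟩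
  have hBE : B ⊆ M.E := hB.trans Set.sdiff_subset
  have h1 : B ∪ (C ∩ M.E) \ J = M.E \ ((M.E \ C) \ B ∪ J) := by
    have hBC : ∀ x ∈ B, x ∈ M.E ∧ x ∉ C := fun x hx ↦ hB hx
    ext x
    grind
  rw [h1, ← dual_isBase_iff (Set.union_subset (Set.sdiff_subset.trans Set.sdiff_subset) hJ),
    ← hiff _ (show (M.E \ C) \ B ⊆ M✶.E \ C from Set.sdiff_subset), ← dual_contract,
    dual_isBase_iff (show (M.E \ C) \ B ⊆ M.E \ C from Set.sdiff_subset), contract_ground,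
    Set.sdiff_sdiff_cancel_left (show B ⊆ M.E \ C from hB)]

/-- The bases of a minor are the subsets of its ground set that a fixed set completes to a base. -/
lemma IsMinor.exists_isBase_iff [M.Finite] {N : Matroid α} (h : N ≤m M) :
    ∃ I, Disjoint I N.E ∧ ∀ B ⊆ N.E, (N.IsBase B ↔ M.IsBase (B ∪ I)) := by
  obtain ⟨C, D, rfl⟩ := h
  obtain ⟨I, hI, hIiff⟩ := M.exists_contract_isBase_iff C
  obtain ⟨J, hJE, hJ, hJiff⟩ := (M ／ C).exists_delete_isBase_iff D
  refine ⟨J ∪ I, Set.disjoint_union_left.2 ⟨hJ, hI.mono_right Set.sdiff_subset⟩, fun B hB ↦ ?_⟩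
  rw [hJiff B hB, hIiff _ (Set.union_subset (hB.trans Set.sdiff_subset) hJE), Set.union_assoc]

/-- A base exchange fixes the elements of `B₁` that it maps into `B₁`. -/
lemma eq_of_isBase_exchange {B₁ : Set α} (hB₁ : M.IsBase B₁) {σ : α → α}
    (h : ∀ x ∈ B₁, M.IsBase ((B₁ \ {x}) ∪ {σ x})) {x : α} (hx : x ∈ B₁) (hσx : σ x ∈ B₁) :
    σ x = x := by
  by_contra hne
  have h1 : (B₁ \ {x}) ∪ {σ x} = B₁ \ {x} := by
    rw [Set.union_eq_left, Set.singleton_subset_iff]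
    exact ⟨hσx, hne⟩
  have h2 := h x hx
  rw [h1] at h2
  exact hB₁.not_isBase_of_ssubset (Set.sdiff_singleton_ssubset.2 hx) h2

lemma IsStronglyBaseOrderable.of_map_isMinor {β : Type u} {N : Matroid β} [N.Finite]
    (hN : N.IsStronglyBaseOrderable) {f : α → β} (hf : Set.InjOn f M.E) (h : M.map f hf ≤m N) :
    M.IsStronglyBaseOrderable := by
  -- The bases of `M` correspond to the bases of `N` that contain `I` and lie in `f '' M.E ∪ I`. An
  -- exchange of `N` between two of them fixes `I` pointwise, hence induces one of `M`.
  obtain ⟨I, hI, hIiff⟩ := h.exists_isBase_iff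
  rw [map_ground] at hI
  have hbase {B : Set α} (hB : B ⊆ M.E) : M.IsBase B ↔ N.IsBase (f '' B ∪ I) := by
    rw [← map_image_isBase_iff hB (hf := hf), hIiff _ (Set.image_mono hB)]
  have hfI {x : α} (hx : x ∈ M.E) : f x ∉ I := fun h ↦ Set.disjoint_left.1 hI h ⟨x, hx, rfl⟩
  intro B₁ B₂ hB₁ hB₂
  have hE₁ := hB₁.subset_ground
  have hE₂ := hB₂.subset_ground
  have hN₁ := (hbase hE₁).1 hB₁
  have hN₂ := (hbase hE₂).1 hB₂
  obtain ⟨σ, hσ, hσX⟩ := hN _ _ hN₁ hN₂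
  have hfix {y : β} (hy : y ∈ I) : σ y = y := by
    obtain ⟨x, hx, rfl⟩ := hσ.surjOn (.inr hy : y ∈ f '' B₂ ∪ I)
    have hN (x) (hx : x ∈ f '' B₁ ∪ I) : N.IsBase ((f '' B₁ ∪ I) \ {x} ∪ {σ x}) := by
      have := (hσX {x} (Set.singleton_subset_iff.2 hx)).1
      rwa [Set.image_singleton] at this
    exact congrArg σ (eq_of_isBase_exchange hN₁ hN hx (.inr hy))
  have hex : ∀ x ∈ B₁, ∃ y ∈ B₂, f y = σ (f x) := by
    intro x hx
    refine (hσ.mapsTo (.inl ⟨x, hx, rfl⟩)).resolve_right fun h' ↦ hfI (hE₁ hx) ?_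
    rwa [← hσ.injOn (.inr h') (.inl ⟨x, hx, rfl⟩) (hfix h')]
  choose! τ hτB hτ using hex
  refine ⟨τ, ⟨hτB, fun x hx y hy hxy ↦ ?_, fun y hy ↦ ?_⟩, fun X hX ↦ ?_⟩
  · refine hf (hE₁ hx) (hE₁ hy) (hσ.injOn (.inl ⟨x, hx, rfl⟩) (.inl ⟨y, hy, rfl⟩) ?_)
    rw [← hτ x hx, ← hτ y hy, hxy]
  · obtain ⟨z, hz, hzy⟩ := hσ.surjOn (.inl ⟨y, hy, rfl⟩ : f y ∈ f '' B₂ ∪ I)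
    rcases hz with ⟨x, hx, rfl⟩ | hz
    · exact ⟨x, hx, hf (hE₂ (hτB x hx)) (hE₂ hy) ((hτ x hx).trans hzy)⟩
    · rw [hfix hz] at hzy
      exact absurd (hzy ▸ hz) (hfI (hE₂ hy))
  · have himg : σ '' (f '' X) = f '' (τ '' X) := by
      rw [Set.image_image, Set.image_image]
      exact Set.image_congr fun x hx ↦ (hτ x (hX hx)).symm
    have hτX : τ '' X ⊆ B₂ := Set.image_subset_iff.2 fun x hx ↦ hτB x (hX hx)
    have hIX {Y : Set α} (hY : Y ⊆ M.E) : I \ f '' Y = I :=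
      sdiff_eq_left.2 (hI.mono_right (Set.image_mono hY))
    have key {B Y Y' : Set α} (hB : B ⊆ M.E) (hY : Y ⊆ B) :
        (f '' B ∪ I) \ f '' Y ∪ f '' Y' = f '' (B \ Y ∪ Y') ∪ I := by
      rw [Set.union_sdiff_distrib, hIX (hY.trans hB), Set.image_union,
        (hf.mono hB).image_sdiff_subset hY, Set.union_right_comm]
    have h' := hσX (f '' X) ((Set.image_mono hX).trans Set.subset_union_left)
    rw [himg, key hE₁ hX, key hE₂ hτX] at h'
    rw [hbase (Set.union_subset (Set.sdiff_subset.trans hE₁) (hτX.trans hE₂)),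
      hbase (Set.union_subset (Set.sdiff_subset.trans hE₂) (hX.trans hE₁))]
    exact h'

theorem IsGammoid.isStronglyBaseOrderable (h : M.IsGammoid) : M.IsStronglyBaseOrderable := by
  obtain ⟨β, N, f, hf, hN, hMN⟩ := h
  have : N.Finite := ⟨hN.1⟩
  exact hN.isStronglyBaseOrderable.of_map_isMinor hf hMN

end BaseOrderable

open Finset

/-! ### Matroids described by their finite independent sets and by their cyclic flats -/

lemma exists_finset_indep_iff {α : Type*} [DecidableEq α] (S : Finset α) (P : Finset α → Prop)
    (h_empty : P ∅) (h_subset : ∀ ⦃I J⦄, P J → I ⊆ J → P I)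
    (h_aug : ∀ ⦃I J⦄, P I → P J → #I < #J → ∃ e ∈ J, e ∉ I ∧ P (insert e I))
    (h_ground : ∀ ⦃I⦄, P I → I ⊆ S) :
    ∃ M : Matroid α, M.E = S ∧ ∀ I : Finset α, M.Indep I ↔ P I :=
  ⟨(IndepMatroid.ofFinset (S : Set α) P h_empty h_subset h_aug
    (fun _ hI ↦ coe_subset.2 (h_ground hI))).matroid, rfl, fun _ ↦
      IndepMatroid.ofFinset_indep (S : Set α) P h_empty h_subset h_aug
        (fun _ hI ↦ coe_subset.2 (h_ground hI))⟩

section CyclicFlats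

variable {α : Type u} {M : Matroid α}

lemma isCyclicSet_iff {X : Set α} :
    M.IsCyclicSet X ↔ ∀ e ∈ X, ∃ K ⊆ X, M.IsCircuit K ∧ e ∈ K := by
  refine ⟨?_, fun h ↦ ⟨{K | M.IsCircuit K ∧ K ⊆ X}, fun K hK ↦ hK.1, ?_⟩⟩
  · rintro ⟨𝒞, h𝒞, rfl⟩ e ⟨K, hK, heK⟩
    exact ⟨K, Set.subset_sUnion_of_mem hK, h𝒞 K hK, heK⟩
  · refine subset_antisymm (fun e he ↦ ?_) (Set.sUnion_subset fun K hK ↦ hK.2)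
    obtain ⟨K, hKX, hK, heK⟩ := h e he
    exact ⟨K, ⟨hK, hKX⟩, heK⟩

lemma isCyclicFlat_closure {K : Set α} (hK : M.IsCircuit K) : M.IsCyclicFlat (M.closure K) := by
  refine ⟨M.isFlat_closure K, isCyclicSet_iff.2 fun e he ↦ ?_⟩
  have hKE := M.subset_closure K hK.subset_ground
  by_cases heK : e ∈ K
  · exact ⟨K, hKE, hK, heK⟩
  · obtain ⟨C, hC, hC', heC⟩ := exists_isCircuit_of_mem_closure he heK
    exact ⟨C, hC.trans (Set.insert_subset he hKE), hC', heC⟩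

/-- The cyclic flats and their ranks determine a matroid: a dependent set contains a circuit `K`,
and the cyclic flat `closure K` is then violated. -/
theorem indep_iff_forall_isCyclicFlat [M.RankFinite] {I : Set α} :
    M.Indep I ↔ I ⊆ M.E ∧ ∀ Z, M.IsCyclicFlat Z → (I ∩ Z).encard ≤ M.eRk Z := by
  refine ⟨fun hI ↦ ⟨hI.subset_ground, fun Z _ ↦ ?_⟩, fun ⟨hIE, hI⟩ ↦ ?_⟩
  · exact (hI.subset Set.inter_subset_left).encard_le_eRk_of_subset Set.inter_subset_right
  · by_contra hdep
    obtain ⟨K, hKI, hK⟩ := Dep.exists_isCircuit_subset ⟨hdep, hIE⟩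
    have h1 := hI _ (isCyclicFlat_closure hK)
    rw [eRk_closure_eq] at h1
    have h2 : K.encard ≤ (I ∩ M.closure K).encard :=
      Set.encard_le_encard (Set.subset_inter hKI (M.subset_closure K hK.subset_ground))
    exact (h2.trans h1).not_gt hK.dep.eRk_lt_encard

end CyclicFlats

/-! ### Elementary split matroids -/

section ElementarySplit

variable {α : Type u} {ι : Type*} [DecidableEq α] {M : Matroid α} {S I : Finset α} {r : ℕ}
  {Z : ι → Finset α} {k : ι → ℕ}

/-- `I` is a subset of `S` of size at most `r` that meets each of the sets `Z i` in at most `k i`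
elements. -/
def SplitIndep (S : Finset α) (r : ℕ) (Z : ι → Finset α) (k : ι → ℕ) (I : Finset α) : Prop :=
  I ⊆ S ∧ #I ≤ r ∧ ∀ i, #(I ∩ Z i) ≤ k i

/-- `M` is the matroid on `S` whose independent sets are the sets satisfying `SplitIndep S r Z k`.
If `r + |Z i ∩ Z j| ≤ k i + k j` for all `i ≠ j`, this is an elementary split matroid, with the
`Z i` as its proper nonempty cyclic flats under mild further conditions; that inequality is not
part of the structure. -/
structure IsElementarySplit (M : Matroid α) (S : Finset α) (r : ℕ) (Z : ι → Finset α)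
    (k : ι → ℕ) : Prop where
  ground_eq : M.E = S
  indep_iff : ∀ I : Finset α, M.Indep I ↔ SplitIndep S r Z k I

lemma SplitIndep.subset {J : Finset α} (hJ : SplitIndep S r Z k J) (hIJ : I ⊆ J) :
    SplitIndep S r Z k I :=
  ⟨hIJ.trans hJ.1, (card_le_card hIJ).trans hJ.2.1,
    fun i ↦ (card_le_card (inter_subset_inter_right hIJ)).trans (hJ.2.2 i)⟩

/-- At most one of the bounds `k i` can be attained by a set of size less than `r`. This is what the
condition `r + |Z i ∩ Z j| ≤ k i + k j` is for. -/
lemma eq_of_tight (hZ : ∀ i j, i ≠ j → r + #(Z i ∩ Z j) ≤ k i + k j) (hI : #I < r) {i j : ι}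
    (hi : k i ≤ #(I ∩ Z i)) (hj : k j ≤ #(I ∩ Z j)) : i = j := by
  by_contra hij
  have h1 := card_union_add_card_inter (I ∩ Z i) (I ∩ Z j)
  have h2 : #(I ∩ Z i ∪ I ∩ Z j) ≤ #I := card_le_card (by grind)
  have h3 : #(I ∩ Z i ∩ (I ∩ Z j)) ≤ #(Z i ∩ Z j) := card_le_card (by grind)
  have := hZ i j hij
  omega

lemma SplitIndep.exists_tight (hI : SplitIndep S r Z k I) (hr : #I < r) {e : α} (heS : e ∈ S)
    (he : ¬ SplitIndep S r Z k (insert e I)) : ∃ i, e ∈ Z i ∧ k i ≤ #(I ∩ Z i) := by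
  by_contra! h
  refine he ⟨insert_subset heS hI.1, (card_insert_le e I).trans hr, fun i ↦ ?_⟩
  by_cases hei : e ∈ Z i
  · rw [insert_inter_of_mem hei]
    exact (card_insert_le _ _).trans (h i hei)
  · rw [insert_inter_of_notMem hei]
    exact hI.2.2 i

lemma SplitIndep.not_insert {e : α} {i : ι} (heI : e ∉ I) (hei : e ∈ Z i)
    (hi : k i ≤ #(I ∩ Z i)) : ¬ SplitIndep S r Z k (insert e I) := by
  intro h
  have := h.2.2 i
  rw [insert_inter_of_mem hei, card_insert_of_notMem (by simp [heI])] at this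
  omega

lemma SplitIndep.exists_insert (hZ : ∀ i j, i ≠ j → r + #(Z i ∩ Z j) ≤ k i + k j)
    {J : Finset α} (hI : SplitIndep S r Z k I) (hJ : SplitIndep S r Z k J) (hIJ : #I < #J) :
    ∃ e ∈ J, e ∉ I ∧ SplitIndep S r Z k (insert e I) := by
  by_contra! h
  have hr : #I < r := hIJ.trans_le hJ.2.1
  -- A single tight set `Z i` blocks every element of `J \ I`, so `J` meets `Z i` in too many
  -- elements.
  obtain ⟨e₀, he₀J, he₀I⟩ := exists_mem_notMem_of_card_lt_card hIJ
  obtain ⟨i, -, hi⟩ := hI.exists_tight hr (hJ.1 he₀J) (h e₀ he₀J he₀I)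
  have hsub : J \ I ⊆ Z i := by
    intro e he
    rw [mem_sdiff] at he
    obtain ⟨j, hej, hj⟩ := hI.exists_tight hr (hJ.1 he.1) (h e he.1 he.2)
    rwa [eq_of_tight hZ hr hi hj]
  have h1 : #(J \ I) + #(J ∩ I ∩ Z i) ≤ #(J ∩ Z i) := by
    rw [← card_union_of_disjoint (by rw [disjoint_left]; grind)]
    exact card_le_card (by grind)
  have h2 : #(I ∩ Z i) ≤ #(I \ J) + #(J ∩ I ∩ Z i) :=
    (card_le_card (by grind)).trans (card_union_le _ _)
  have h3 := card_sdiff_add_card_inter I J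
  have h4 := card_sdiff_add_card_inter J I
  rw [inter_comm] at h4
  have := hJ.2.2 i
  omega

/-- The condition on the pairs `Z i`, `Z j` is inherited by the complements, with the rank `r'` and
the bounds `k'` of the dual matroid. -/
lemma add_card_sdiff_inter_sdiff_le (hZ : ∀ i j, i ≠ j → r + #(Z i ∩ Z j) ≤ k i + k j)
    (hZS : ∀ i, Z i ⊆ S) {r' : ℕ} {k' : ι → ℕ} (hr' : r + r' = #S)
    (hk' : ∀ i, k' i + r = #(S \ Z i) + k i) (i j : ι) (hij : i ≠ j) :
    r' + #((S \ Z i) ∩ (S \ Z j)) ≤ k' i + k' j := by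
  have h1 := hZ i j hij
  have h2 := hk' i
  have h3 := hk' j
  have h4 := card_union_add_card_inter (Z i) (Z j)
  have h5 := card_sdiff_add_card_eq_card (hZS i)
  have h6 := card_sdiff_add_card_eq_card (hZS j)
  have h7 := card_sdiff_add_card_eq_card (union_subset (hZS i) (hZS j))
  have h8 : (S \ Z i) ∩ (S \ Z j) = S \ (Z i ∪ Z j) := by grind
  rw [h8]
  omega

theorem exists_isElementarySplit (S : Finset α) (r : ℕ) (k : ι → ℕ)
    (hZ : ∀ i j, i ≠ j → r + #(Z i ∩ Z j) ≤ k i + k j) :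
    ∃ M : Matroid α, M.IsElementarySplit S r Z k := by
  obtain ⟨M, hME, hM⟩ := exists_finset_indep_iff S (SplitIndep S r Z k)
    ⟨by simp, by simp, by simp⟩ (fun _ _ hJ hIJ ↦ hJ.subset hIJ)
    (fun _ _ hI hJ hIJ ↦ hI.exists_insert hZ hJ hIJ) (fun _ hI ↦ hI.1)
  exact ⟨M, hME, hM⟩

namespace IsElementarySplit

lemma exists_coe_eq (h : M.IsElementarySplit S r Z k) {X : Set α} (hX : X ⊆ M.E) :
    ∃ Y : Finset α, (Y : Set α) = X ∧ Y ⊆ S := by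
  rw [h.ground_eq] at hX
  lift X to Finset α using S.finite_toSet.subset hX
  exact ⟨X, rfl, by simpa using hX⟩

lemma ext {M' : Matroid α} (h : M.IsElementarySplit S r Z k)
    (h' : M'.IsElementarySplit S r Z k) : M = M' := by
  refine ext_indep (by rw [h.ground_eq, h'.ground_eq]) fun I hI ↦ ?_
  obtain ⟨I, rfl, -⟩ := h.exists_coe_eq hI
  rw [h.indep_iff, h'.indep_iff]

lemma mem_closure_iff_not_splitIndep_insert (h : M.IsElementarySplit S r Z k)
    (hI : SplitIndep S r Z k I) {e : α} (heS : e ∈ S) (heI : e ∉ I) :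
    e ∈ M.closure I ↔ ¬ SplitIndep S r Z k (insert e I) := by
  have hI' := (h.indep_iff I).2 hI
  rw [hI'.mem_closure_iff_of_notMem (by simpa using heI), Dep, ← coe_insert, h.indep_iff,
    and_iff_left]
  rw [h.ground_eq, coe_subset]
  exact insert_subset heS hI.1

lemma splitIndep_of_subset (hZ : ∀ i j, i ≠ j → r + #(Z i ∩ Z j) ≤ k i + k j)
    (hZS : ∀ i, Z i ⊆ S) (hkr : ∀ i, k i < r) {i : ι} (hI : I ⊆ Z i) (hcard : #I ≤ k i) :
    SplitIndep S r Z k I := by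
  refine ⟨hI.trans (hZS i), hcard.trans (hkr i).le, fun j ↦ ?_⟩
  obtain rfl | hij := eq_or_ne i j
  · exact (card_le_card inter_subset_left).trans hcard
  · have h1 : #(I ∩ Z j) ≤ #(Z i ∩ Z j) := card_le_card (by grind)
    have := hZ i j hij
    have := hkr i
    omega

lemma eRk_eq (h : M.IsElementarySplit S r Z k)
    (hZ : ∀ i j, i ≠ j → r + #(Z i ∩ Z j) ≤ k i + k j)
    (hZS : ∀ i, Z i ⊆ S) (hkr : ∀ i, k i < r) (hkZ : ∀ i, k i < #(Z i)) (i : ι) :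
    M.eRk (Z i) = k i := by
  obtain ⟨J, hJ⟩ := M.exists_isBasis (Z i : Set α) (by rw [h.ground_eq]; exact_mod_cast hZS i)
  obtain ⟨J, rfl, -⟩ := h.exists_coe_eq hJ.indep.subset_ground
  rw [← hJ.encard_eq_eRk, Set.encard_coe_eq_coe_finsetCard]
  have hJ1 := (h.indep_iff J).1 hJ.indep
  have hJ2 : J ⊆ Z i := coe_subset.1 hJ.subset
  have h1 := hJ1.2.2 i
  rw [inter_eq_left.2 hJ2] at h1
  obtain ⟨K, hK, hKc⟩ := exists_subset_card_eq (hkZ i).le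
  have hKi := (h.indep_iff K).2 (splitIndep_of_subset hZ hZS hkr hK hKc.le)
  have h2 := hKi.encard_le_eRk_of_subset (coe_subset.2 hK)
  rw [← hJ.encard_eq_eRk, Set.encard_coe_eq_coe_finsetCard, Set.encard_coe_eq_coe_finsetCard,
    Nat.cast_le] at h2
  norm_cast
  omega

lemma isCircuit (h : M.IsElementarySplit S r Z k)
    (hZ : ∀ i j, i ≠ j → r + #(Z i ∩ Z j) ≤ k i + k j)
    (hZS : ∀ i, Z i ⊆ S) (hkr : ∀ i, k i < r) {i : ι} {K : Finset α} (hK : K ⊆ Z i)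
    (hcard : #K = k i + 1) : M.IsCircuit K := by
  rw [isCircuit_iff_forall_ssubset, Dep, h.ground_eq, coe_subset, h.indep_iff]
  refine ⟨⟨fun hK' ↦ ?_, hK.trans (hZS i)⟩, fun I hI ↦ ?_⟩
  · have := hK'.2.2 i
    rw [inter_eq_left.2 hK] at this
    omega
  · lift I to Finset α using K.finite_toSet.subset hI.subset
    rw [coe_ssubset] at hI
    have := card_lt_card hI
    rw [h.indep_iff]
    exact splitIndep_of_subset hZ hZS hkr (hI.subset.trans hK) (by omega)

lemma isFlat (h : M.IsElementarySplit S r Z k)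
    (hZ : ∀ i j, i ≠ j → r + #(Z i ∩ Z j) ≤ k i + k j)
    (hZS : ∀ i, Z i ⊆ S) (hkr : ∀ i, k i < r) (hkZ : ∀ i, k i < #(Z i)) (i : ι) :
    M.IsFlat (Z i) := by
  have hZE : (Z i : Set α) ⊆ M.E := by rw [h.ground_eq]; exact_mod_cast hZS i
  rw [isFlat_iff_closure_eq]
  refine subset_antisymm (fun e he ↦ ?_) (M.subset_closure _ hZE)
  by_contra hei
  obtain ⟨K, hK, hKc⟩ := exists_subset_card_eq (hkZ i).le
  have hK' := splitIndep_of_subset hZ hZS hkr hK hKc.le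
  have heS : e ∈ S := by
    have := M.closure_subset_ground _ he
    rw [h.ground_eq] at this
    exact_mod_cast this
  have hKi : #(K ∩ Z i) = k i := by rw [inter_eq_left.2 hK, hKc]
  have hcl : (Z i : Set α) ⊆ M.closure K := by
    intro z hz
    by_cases hzK : z ∈ K
    · exact M.mem_closure_of_mem (by simpa using hzK) ((h.indep_iff K).2 hK').subset_ground
    · rw [h.mem_closure_iff_not_splitIndep_insert hK' (hZS i hz) hzK]
      exact SplitIndep.not_insert hzK hz hKi.ge
  have he' := M.closure_subset_closure_of_subset_closure hcl he
  rw [h.mem_closure_iff_not_splitIndep_insert hK' heS fun heK ↦ hei (hK heK)] at he'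
  obtain ⟨j, hej, hj⟩ := hK'.exists_tight (by rw [hKc]; exact hkr i) heS he'
  obtain rfl := eq_of_tight hZ (by rw [hKc]; exact hkr i) hKi.ge hj
  exact hei hej

/-- If the `Z i` cover `S` and `0 < k i < min r |Z i|`, the cyclic flats are exactly `∅`, `S` and
the `Z i`. -/
lemma isCyclicFlat_iff (h : M.IsElementarySplit S r Z k)
    (hZ : ∀ i j, i ≠ j → r + #(Z i ∩ Z j) ≤ k i + k j) (hZS : ∀ i, Z i ⊆ S)
    (hk0 : ∀ i, 0 < k i) (hkr : ∀ i, k i < r) (hkZ : ∀ i, k i < #(Z i)) (hr : 0 < r)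
    (hcov : ∀ x ∈ S, ∃ i, x ∈ Z i) {X : Set α} :
    M.IsCyclicFlat X ↔ X = ∅ ∨ (∃ i, X = Z i) ∨ X = S := by
  have hcyc (i : ι) (e : α) (he : e ∈ Z i) : ∃ K ⊆ Z i, M.IsCircuit K ∧ e ∈ K := by
    obtain ⟨K, heK, hK, hKc⟩ := exists_subsuperset_card_eq (singleton_subset_iff.2 he)
      (by simp : #{e} ≤ k i + 1) (hkZ i)
    exact ⟨K, hK, h.isCircuit hZ hZS hkr hK hKc, by simpa using heK⟩
  constructor
  · rintro ⟨hF, hC⟩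
    rw [isCyclicSet_iff] at hC
    have hXE := hF.subset_ground
    obtain ⟨X, rfl, hXS⟩ := h.exists_coe_eq hXE
    -- `X` is the closure of its basis `I`: it consists of `I` and of the elements that `I` blocks.
    obtain ⟨I, hI⟩ := M.exists_isBasis (X : Set α)
    obtain ⟨I, rfl, -⟩ := h.exists_coe_eq hI.indep.subset_ground
    have hIX : I ⊆ X := coe_subset.1 hI.subset
    have hIi := (h.indep_iff I).1 hI.indep
    have hcl : M.closure I = X := by rw [hI.closure_eq_closure, hF.closure]
    have hmem {e : α} (heS : e ∈ S) (heI : e ∉ I) :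
        e ∈ X ↔ ¬ SplitIndep S r Z k (insert e I) := by
      rw [← h.mem_closure_iff_not_splitIndep_insert hIi heS heI, hcl, mem_coe]
    rcases hIi.2.1.eq_or_lt with hIr | hIr
    · refine .inr (.inr ?_)
      rw [coe_inj]
      refine subset_antisymm hXS fun e he ↦ ?_
      by_cases heI : e ∈ I
      · exact hIX heI
      · rw [hmem he heI]
        intro h'
        have := h'.2.1
        rw [card_insert_of_notMem heI] at this
        omega
    by_cases hXI : X ⊆ I
    · left
      rw [Set.eq_empty_iff_forall_notMem]
      intro e he
      obtain ⟨K, hKX, hK, -⟩ := hC e he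
      exact hK.not_indep (hI.indep.subset (hKX.trans (by exact_mod_cast hXI)))
    -- Otherwise a unique bound `k i` is attained by `I`, and it blocks every element of `X \ I`.
    obtain ⟨e₀, he₀X, he₀I⟩ := Finset.not_subset.1 hXI
    obtain ⟨i, he₀i, hi⟩ := hIi.exists_tight hIr (hXS he₀X) ((hmem (hXS he₀X) he₀I).1 he₀X)
    have hXZ : X \ I ⊆ Z i := by
      intro e he
      rw [mem_sdiff] at he
      obtain ⟨j, hej, hj⟩ := hIi.exists_tight hIr (hXS he.1) ((hmem (hXS he.1) he.2).1 he.1)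
      rwa [eq_of_tight hZ hIr hi hj]
    refine .inr (.inl ⟨i, ?_⟩)
    rw [coe_inj]
    refine subset_antisymm (fun e he ↦ ?_) fun z hz ↦ ?_
    -- An element `e` of `X` outside `Z i` lies in `I`. As `e` is in a circuit inside `X`, some
    -- basis `J` of `X` avoids `e`; having as many elements as `I` and fewer outside `Z i`, it
    -- exceeds `k i`.
    · by_contra hei
      obtain ⟨K, hKX, hK, heK⟩ := hC e he
      obtain ⟨J, hJ⟩ := M.exists_isBasis ((X : Set α) \ {e}) (Set.sdiff_subset.trans hXE)
      have hJX : M.IsBasis J X := by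
        refine hJ.isBasis_of_closure_eq_closure (hJ.subset.trans Set.sdiff_subset) ?_
        refine (M.closure_subset_closure Set.sdiff_subset).antisymm
          (M.closure_subset_closure_of_subset_closure fun x hx ↦ ?_)
        obtain rfl | hxe := eq_or_ne x e
        · exact M.closure_subset_closure (Set.sdiff_subset_sdiff_left hKX)
            (hK.mem_closure_sdiff_singleton_of_mem heK)
        · exact M.mem_closure_of_mem ⟨hx, hxe⟩ (Set.sdiff_subset.trans hXE)
      have hc := hJX.encard_eq_encard hI
      obtain ⟨J, rfl, -⟩ := h.exists_coe_eq hJ.indep.subset_ground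
      rw [Set.encard_coe_eq_coe_finsetCard, Set.encard_coe_eq_coe_finsetCard, Nat.cast_inj] at hc
      have hJi := ((h.indep_iff J).1 hJ.indep).2.2 i
      have hJsub : J \ Z i ⊆ (I \ Z i).erase e := by
        intro x hx
        have hx1 : x ∈ X ∧ x ≠ e := by simpa using hJ.subset (mem_coe.2 (mem_sdiff.1 hx).1)
        grind
      have h1 := card_le_card hJsub
      have heI : e ∈ I := by grind
      have h2 := card_erase_add_one (mem_sdiff.2 ⟨heI, hei⟩)
      have h3 := card_sdiff_add_card_inter I (Z i)
      have h4 := card_sdiff_add_card_inter J (Z i)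
      omega
    · by_cases hzI : z ∈ I
      · exact hIX hzI
      · rw [hmem (hZS i hz) hzI]
        exact SplitIndep.not_insert hzI hz hi
  · rintro (rfl | ⟨i, rfl⟩ | rfl)
    · refine ⟨?_, isCyclicSet_iff.2 (by simp)⟩
      rw [isFlat_iff_closure_eq, Set.eq_empty_iff_forall_notMem]
      intro e he
      have heS : e ∈ S := by
        have := M.closure_subset_ground _ he
        rw [h.ground_eq] at this
        exact_mod_cast this
      rw [← coe_empty, h.mem_closure_iff_not_splitIndep_insert ⟨by simp, by simp, by simp⟩ heS
        (by simp)] at he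
      refine he ⟨by simpa using heS, by rwa [insert_empty_eq, card_singleton], fun i ↦ ?_⟩
      exact (card_le_card inter_subset_left).trans
        (by rw [insert_empty_eq, card_singleton]; exact hk0 i)
    · refine ⟨h.isFlat hZ hZS hkr hkZ i, isCyclicSet_iff.2 fun e he ↦ ?_⟩
      obtain ⟨K, hK, hK'⟩ := hcyc i e he
      exact ⟨K, by exact_mod_cast hK, hK'⟩
    · refine ⟨by rw [← h.ground_eq]; exact M.ground_isFlat, isCyclicSet_iff.2 fun e he ↦ ?_⟩
      obtain ⟨i, hi⟩ := hcov e he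
      obtain ⟨K, hK, hK'⟩ := hcyc i e hi
      exact ⟨K, by exact_mod_cast hK.trans (hZS i), hK'⟩

lemma isBase_iff (h : M.IsElementarySplit S r Z k) (hB : ∃ B, SplitIndep S r Z k B ∧ #B = r) :
    M.IsBase I ↔ SplitIndep S r Z k I ∧ #I = r := by
  obtain ⟨B, hB, hBr⟩ := hB
  have hI : M.Indep I ∧ #I = r → M.IsBase I := by
    rintro ⟨hI, hIr⟩
    rw [isBase_iff_maximal_indep, maximal_subset_iff]
    refine ⟨hI, fun J hJ hIJ ↦ ?_⟩
    obtain ⟨J, rfl, -⟩ := h.exists_coe_eq hJ.subset_ground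
    rw [coe_inj]
    exact eq_of_subset_of_card_le (coe_subset.1 hIJ) (((h.indep_iff J).1 hJ).2.1.trans hIr.ge)
  have hBB : M.IsBase B := by
    have hBi := (h.indep_iff B).2 hB
    rw [isBase_iff_maximal_indep, maximal_subset_iff]
    refine ⟨hBi, fun J hJ hIJ ↦ ?_⟩
    obtain ⟨J, rfl, -⟩ := h.exists_coe_eq hJ.subset_ground
    rw [coe_inj]
    exact eq_of_subset_of_card_le (coe_subset.1 hIJ) (((h.indep_iff J).1 hJ).2.1.trans hBr.ge)
  rw [← h.indep_iff]
  refine ⟨fun hI ↦ ⟨hI.indep, ?_⟩, hI⟩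
  have := hI.encard_eq_encard_of_isBase hBB
  rw [Set.encard_coe_eq_coe_finsetCard, Set.encard_coe_eq_coe_finsetCard, Nat.cast_inj] at this
  omega

lemma eRank_eq (h : M.IsElementarySplit S r Z k) (hB : ∃ B, SplitIndep S r Z k B ∧ #B = r) :
    M.eRank = r := by
  obtain ⟨B, hB', hBr⟩ := id hB
  rw [← ((h.isBase_iff hB).2 ⟨hB', hBr⟩).encard_eq_eRank, Set.encard_coe_eq_coe_finsetCard, hBr]

lemma contract (h : M.IsElementarySplit S r Z k) {x : α} (hx : SplitIndep S r Z k {x}) :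
    (M ／ {x}).IsElementarySplit (S.erase x) (r - 1) (fun i ↦ (Z i).erase x)
      (fun i ↦ if x ∈ Z i then k i - 1 else k i) := by
  have hx' := (h.indep_iff {x}).2 hx
  rw [coe_singleton] at hx'
  refine ⟨by rw [contract_ground, h.ground_eq, coe_erase], fun I ↦ ?_⟩
  rw [hx'.contract_indep_iff, Set.disjoint_singleton_right, Set.union_singleton, ← coe_insert,
    h.indep_iff, mem_coe]
  by_cases hxI : x ∈ I
  · simp only [hxI, not_true_eq_false, false_and, SplitIndep, false_iff, not_and]
    intro h'
    simpa using h' hxI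
  have hr : 1 ≤ r := by simpa using hx.2.1
  have hcard (i : ι) : #(insert x I ∩ Z i) ≤ k i ↔
      #(I ∩ (Z i).erase x) ≤ if x ∈ Z i then k i - 1 else k i := by
    rw [inter_erase, erase_eq_of_notMem (by simp [hxI])]
    split_ifs with hxi
    · have := hx.2.2 i
      rw [singleton_inter_of_mem hxi, card_singleton] at this
      rw [insert_inter_of_mem hxi, card_insert_of_notMem (by simp [hxI])]
      omega
    · rw [insert_inter_of_notMem hxi]
  have hS : insert x I ⊆ S ↔ I ⊆ S.erase x := by
    have : x ∈ S := by simpa using hx.1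
    grind
  have hr' : #(insert x I) ≤ r ↔ #I ≤ r - 1 := by
    rw [card_insert_of_notMem hxI]
    omega
  simp only [SplitIndep, hxI, not_false_eq_true, true_and, hcard, hS, hr']

/-- Complementing a base of size `r` turns the bound `k i` on its intersection with `Z i` into the
bound `|S \ Z i| + k i - r` on the intersection with `S \ Z i`. -/
lemma dual (h : M.IsElementarySplit S r Z k)
    (hZ : ∀ i j, i ≠ j → r + #(Z i ∩ Z j) ≤ k i + k j) (hZS : ∀ i, Z i ⊆ S)
    (hB : ∃ B, SplitIndep S r Z k B ∧ #B = r) {r' : ℕ} {k' : ι → ℕ} (hr' : r + r' = #S)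
    (hk' : ∀ i, k' i + r = #(S \ Z i) + k i) :
    M✶.IsElementarySplit S r' (fun i ↦ S \ Z i) k' := by
  obtain ⟨N, hN⟩ := exists_isElementarySplit S r' k' (add_card_sdiff_inter_sdiff_le hZ hZS hr' hk')
  have key (I : Finset α) (hI : I ⊆ S) : SplitIndep S r Z k I ∧ #I = r ↔
      SplitIndep S r' (fun i ↦ S \ Z i) k' (S \ I) ∧ #(S \ I) = r' := by
    have h1 := card_sdiff_add_card_eq_card hI
    have h2 (i : ι) (hIr : #I = r) : #(I ∩ Z i) ≤ k i ↔ #((S \ I) ∩ (S \ Z i)) ≤ k' i := by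
      have h3 := card_sdiff_add_card_inter I (Z i)
      have h4 := card_sdiff_add_card_inter (S \ Z i) I
      have h5 : (S \ Z i) ∩ I = I \ Z i := by grind
      have h6 : (S \ Z i) \ I = (S \ I) ∩ (S \ Z i) := by grind
      have := hk' i
      rw [h5, h6] at h4
      omega
    constructor
    · rintro ⟨⟨-, -, hI3⟩, hIr⟩
      exact ⟨⟨sdiff_subset, by omega, fun i ↦ (h2 i hIr).1 (hI3 i)⟩, by omega⟩
    · rintro ⟨⟨-, -, hI3⟩, hIr⟩
      have hIr' : #I = r := by omega
      exact ⟨⟨hI, by omega, fun i ↦ (h2 i hIr').2 (hI3 i)⟩, by omega⟩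
  have hB' : ∃ B, SplitIndep S r' (fun i ↦ S \ Z i) k' B ∧ #B = r' := by
    obtain ⟨B, hB⟩ := hB
    exact ⟨S \ B, (key B hB.1.1).1 hB⟩
  suffices M✶ = N by rwa [this]
  refine ext_isBase (by rw [dual_ground, h.ground_eq, hN.ground_eq]) fun B hBE ↦ ?_
  rw [dual_ground] at hBE
  obtain ⟨B, rfl, hBS⟩ := h.exists_coe_eq hBE
  rw [dual_isBase_iff hBE, h.ground_eq, ← coe_sdiff, h.isBase_iff hB, hN.isBase_iff hB',
    key _ sdiff_subset, Finset.sdiff_sdiff_eq_self hBS]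

end IsElementarySplit

end ElementarySplit

/-! ### Transversal matroids and Hall's condition -/

section Transversal

variable {α : Type u} {β J : Type*} [DecidableEq J]

/-- Hall's condition for matching the elements `x` of `I` injectively with elements of `t x`. -/
def HallCondition (t : β → Finset J) (I : Finset β) : Prop :=
  ∀ X ⊆ I, #X ≤ #(X.biUnion t)

lemma HallCondition.subset {t : β → Finset J} {I I' : Finset β} (h : HallCondition t I')
    (hI : I ⊆ I') : HallCondition t I :=
  fun X hX ↦ h X (hX.trans hI)

variable [DecidableEq β]

lemma hallCondition_iff_exists_injective (t : β → Finset J) (I : Finset β) :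
    HallCondition t I ↔
      ∃ φ : ↥(I : Set β) → J, Function.Injective φ ∧ ∀ x : ↥(I : Set β), φ x ∈ t x := by
  rw [← Finset.all_card_le_biUnion_card_iff_exists_injective (fun x : (I : Set β) ↦ t x)]
  have hmap (s : Finset (I : Set β)) :
      (s.map (Function.Embedding.subtype _)).biUnion t = s.biUnion fun x ↦ t x := by
    ext
    simp
  constructor
  · intro h s
    have := h (s.map (Function.Embedding.subtype _)) fun x hx ↦ by
      obtain ⟨y, -, rfl⟩ := mem_map.1 hx
      exact y.2
    rwa [card_map, hmap] at this
  · intro h X hX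
    have := h (X.subtype (· ∈ (I : Set β)))
    have h' : (X.subtype (· ∈ (I : Set β))).map (Function.Embedding.subtype _) = X :=
      subtype_map_of_mem fun x hx ↦ hX hx
    rw [← h', card_map, hmap]
    exact this

/-- The augmentation axiom for transversal matroids, from Hall's condition alone. -/
lemma HallCondition.exists_insert {t : β → Finset J} {I I' : Finset β} (hI : HallCondition t I)
    (hI' : HallCondition t I') (hcard : #I < #I') :
    ∃ e ∈ I', e ∉ I ∧ HallCondition t (insert e I) := by
  by_contra! hcon
  -- The sets `Y ⊆ I` with at most `|Y|` neighbours are closed under union. The largest of them,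
  -- `K`, has among its neighbours all neighbours of every element `e` of `I'` that cannot be added
  -- to `I`.
  let T : Finset (Finset β) := {Y ∈ I.powerset | #(Y.biUnion t) ≤ #Y}
  have hT (Y : Finset β) : Y ∈ T ↔ Y ⊆ I ∧ #(Y.biUnion t) ≤ #Y := by simp [T]
  obtain ⟨K, hK, hmax⟩ := exists_max_image T card ⟨∅, by simp [hT]⟩
  have hKI := ((hT K).1 hK).1
  have hKt := ((hT K).1 hK).2
  have hsub (e : β) (he : e ∈ I' \ I) : t e ⊆ K.biUnion t := by
    rw [mem_sdiff] at he
    obtain ⟨X, hX, hXt⟩ : ∃ X ⊆ insert e I, #(X.biUnion t) < #X := by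
      simpa [HallCondition] using hcon e he.1 he.2
    have heX : e ∈ X := by
      by_contra heX
      exact (hI X (by grind)).not_gt hXt
    have hYI : X.erase e ⊆ I := by grind
    have h1 := hI _ hYI
    have h2 := card_erase_add_one heX
    have h3 : (X.erase e).biUnion t ⊆ X.biUnion t := biUnion_subset_biUnion_of_subset_left _
      (erase_subset _ _)
    have h4 : (X.erase e).biUnion t = X.biUnion t := eq_of_subset_of_card_le h3 (by omega)
    have hU : X.erase e ∪ K ∈ T := by
      rw [hT]
      refine ⟨union_subset hYI hKI, ?_⟩
      have h5 := card_union_add_card_inter ((X.erase e).biUnion t) (K.biUnion t)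
      have h6 := card_union_add_card_inter (X.erase e) K
      have h7 := hI (X.erase e ∩ K) (inter_subset_right.trans hKI)
      have h8 : #((X.erase e ∩ K).biUnion t) ≤ #((X.erase e).biUnion t ∩ K.biUnion t) :=
        card_le_card (subset_inter (biUnion_subset_biUnion_of_subset_left _ inter_subset_left)
          (biUnion_subset_biUnion_of_subset_left _ inter_subset_right))
      rw [union_biUnion]
      rw [h4] at h5 h8 h1
      rw [h4]
      omega
    have h9 : X.erase e ⊆ K := by
      have := eq_of_subset_of_card_le (subset_union_right : K ⊆ X.erase e ∪ K) (hmax _ hU)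
      rw [this]
      exact subset_union_left
    exact ((subset_biUnion_of_mem t heX).trans h4.ge).trans
      (biUnion_subset_biUnion_of_subset_left _ h9)
  have h1 := hI' (I' ∩ K ∪ I' \ I) (by grind)
  have h2 : (I' ∩ K ∪ I' \ I).biUnion t ⊆ K.biUnion t := by
    rw [biUnion_subset]
    intro e he
    rw [mem_union] at he
    rcases he with he | he
    · exact subset_biUnion_of_mem t (mem_inter.1 he).2
    · exact hsub e he
  have h3 := card_le_card h2
  rw [card_union_of_disjoint (by rw [disjoint_left]; grind)] at h1
  have h4 := card_sdiff_add_card_inter K I'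
  have h5 : #(K \ I') ≤ #(I \ I') := card_le_card (by grind)
  have h6 := card_sdiff_add_card_inter I I'
  have h7 := card_sdiff_add_card_inter I' I
  rw [inter_comm] at h4 h7
  omega

theorem exists_indep_iff_hallCondition (S : Finset β) (t : β → Finset J) :
    ∃ M : Matroid β, M.E = S ∧
      ∀ I : Finset β, M.Indep I ↔ I ⊆ S ∧ HallCondition t I := by
  refine exists_finset_indep_iff S _ ⟨by simp, ?_⟩ (fun I I' h hI ↦ ⟨hI.trans h.1, h.2.subset hI⟩)
    (fun I I' hI hI' hcard ↦ ?_) fun _ h ↦ h.1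
  · intro X hX
    simp [subset_empty.1 hX]
  · obtain ⟨e, heI', heI, he⟩ := hI.2.exists_insert hI'.2 hcard
    exact ⟨e, heI', heI, insert_subset (hI'.1 heI') hI.1, he⟩

lemma isTransversal_of_hallCondition {β : Type u} [DecidableEq β] {M : Matroid β} {S : Finset β}
    (hS : M.E = S) (t : β → Finset J) (U : Finset J) (hU : ∀ x ∈ S, t x ⊆ U)
    (hM : ∀ I : Finset β, M.Indep I ↔ I ⊆ S ∧ HallCondition t I) : M.IsTransversal := by
  refine ⟨by rw [hS]; exact S.finite_toSet, #U,
    fun i ↦ {x | x ∈ S ∧ (U.equivFin.symm i : J) ∈ t x}, fun i x hx ↦ ?_, fun I ↦ ?_⟩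
  · rw [hS]
    exact hx.1
  by_cases hI : I ⊆ M.E
  swap
  · exact iff_of_false (fun h ↦ hI h.subset_ground) fun h ↦ hI h.1
  have hIS := hI
  rw [hS] at hIS
  lift I to Finset β using S.finite_toSet.subset hIS
  rw [hM, and_iff_right (coe_subset.1 hIS), and_iff_right hI, hallCondition_iff_exists_injective]
  constructor
  · rintro ⟨φ, hφ, hφt⟩
    refine ⟨fun x ↦ U.equivFin ⟨φ x, hU x (hIS x.2) (hφt x)⟩, fun x y hxy ↦ ?_, fun x ↦ ?_⟩
    · simpa using hφ (by simpa using hxy)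
    · simpa using ⟨hIS x.2, hφt x⟩
  · rintro ⟨φ, hφ, hφt⟩
    refine ⟨fun x ↦ U.equivFin.symm (φ x), fun x y hxy ↦ hφ ?_, fun x ↦ (hφt x).2⟩
    simpa using Subtype.coe_injective hxy

/-- Let the bounds satisfy `∑ (r - k i) = r` and let every element lie in at most two of the `Z i`.
Then the sets `S \ Z i`, each repeated `r - k i` times, present the matroid: a nonempty set `X` has
`r - ∑ (r - k i)` neighbours, the sum being over the `i` with `X ⊆ Z i`, so Hall's condition
amounts to `|X| ≤ r`, to `|X| ≤ k i` or to a consequence of `r + |Z i ∩ Z j| ≤ k i + k j` according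
as there are zero, one or two such `i`. -/
lemma IsElementarySplit.isTransversal {α : Type u} {ι : Type*} [DecidableEq α] [Fintype ι]
    [DecidableEq ι] {M : Matroid α} {S : Finset α} {r : ℕ} {Z : ι → Finset α} {k : ι → ℕ}
    (h : M.IsElementarySplit S r Z k)
    (hZ : ∀ i j, i ≠ j → r + #(Z i ∩ Z j) ≤ k i + k j) (hkr : ∀ i, k i ≤ r)
    (hsum : ∑ i, (r - k i) = r) (hS : ∀ x ∈ S, #{i | x ∈ Z i} ≤ 2) : M.IsTransversal := by
  let t (x : α) : Finset (Σ i, Fin (r - k i)) := {p | x ∉ Z p.1}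
  refine isTransversal_of_hallCondition h.ground_eq t univ (fun _ _ ↦ subset_univ _) fun I ↦ ?_
  rw [h.indep_iff]
  have hcard (X : Finset α) : #(X.biUnion t) + ∑ i with X ⊆ Z i, (r - k i) = r := by
    have h1 : X.biUnion t = ({i | ¬ X ⊆ Z i} : Finset ι).sigma fun _ ↦ univ := by
      ext p
      simp [t, Finset.not_subset]
    rw [h1, card_sigma]
    simp only [card_univ, Fintype.card_fin]
    rw [add_comm, sum_filter_add_sum_filter_not, hsum]
  have hle (X : Finset α) : #(X.biUnion t) ≤ r := by
    have := hcard X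
    omega
  constructor
  · rintro ⟨hIS, hIr, hIk⟩
    refine ⟨hIS, fun X hX ↦ ?_⟩
    have hc := hcard X
    generalize hT : ({i | X ⊆ Z i} : Finset ι) = T at hc
    have hT' (i : ι) : i ∈ T ↔ X ⊆ Z i := by simp [← hT]
    have hcases : #T = 0 ∨ #T = 1 ∨ #T = 2 ∨ 2 < #T := by omega
    rcases hcases with h0 | h1 | h2 | h3
    · rw [card_eq_zero.1 h0, sum_empty] at hc
      have := card_le_card hX
      omega
    · obtain ⟨i, rfl⟩ := card_eq_one.1 h1
      have h4 := hkr i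
      have h5 := hIk i
      have h6 : #X ≤ #(I ∩ Z i) := card_le_card (subset_inter hX ((hT' i).1 (by simp)))
      rw [sum_singleton] at hc
      omega
    · obtain ⟨i, j, hij, rfl⟩ := card_eq_two.1 h2
      have h4 := hkr i
      have h5 := hkr j
      have h6 := hZ i j hij
      have h7 : #X ≤ #(Z i ∩ Z j) :=
        card_le_card (subset_inter ((hT' i).1 (by simp)) ((hT' j).1 (by simp)))
      rw [sum_pair hij] at hc
      omega
    · obtain rfl | ⟨x, hx⟩ := X.eq_empty_or_nonempty
      · simp
      · have h4 := hS x (hIS (hX hx))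
        have h5 : #T ≤ #{i | x ∈ Z i} := card_le_card fun i hi ↦ by simpa using (hT' i).1 hi hx
        omega
  · rintro ⟨hIS, hI⟩
    refine ⟨hIS, (hI I subset_rfl).trans (hle I), fun i ↦ ?_⟩
    have h1 := hI (I ∩ Z i) inter_subset_left
    have h2 := hcard (I ∩ Z i)
    have h3 : r - k i ≤ ∑ j with I ∩ Z i ⊆ Z j, (r - k j) :=
      single_le_sum (f := fun j ↦ r - k j) (fun _ _ ↦ Nat.zero_le _) (by simp)
    have h4 := hkr i
    omega

/-- If `∑ (r - k i) = r + 1` and every element lies in exactly two of the `Z i` and outside exactly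
two of them, then contracting `x` lowers `r` by one and `r - k i` by one for the two `i` with
`x ∉ Z i`, so that the contraction has the transversal presentation of
`IsElementarySplit.isTransversal`. -/
lemma IsElementarySplit.isTransversal_contract {α : Type u} {ι : Type*} [DecidableEq α]
    [Fintype ι] [DecidableEq ι] {M : Matroid α} {S : Finset α} {r : ℕ} {Z : ι → Finset α}
    {k : ι → ℕ} (h : M.IsElementarySplit S r Z k)
    (hZ : ∀ i j, i ≠ j → r + #(Z i ∩ Z j) ≤ k i + k j) (hk0 : ∀ i, 0 < k i) (hkr : ∀ i, k i < r)
    (hr : 0 < r) (hsum : ∑ i, (r - k i) = r + 1) (hin : ∀ x ∈ S, #{i | x ∈ Z i} = 2)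
    (hout : ∀ x ∈ S, #{i | x ∉ Z i} = 2) {x : α} (hx : x ∈ S) : (M ／ {x}).IsTransversal := by
  have hxi : SplitIndep S r Z k {x} := by
    refine ⟨by simpa using hx, by rwa [card_singleton], fun i ↦ ?_⟩
    exact (card_le_card inter_subset_left).trans (by rw [card_singleton]; exact hk0 i)
  refine (h.contract hxi).isTransversal (fun i j hij ↦ ?_) (fun i ↦ ?_) ?_ fun y hy ↦ ?_
  · have h1 := hZ i j hij
    have h2 := hk0 i
    have h3 := hk0 j
    rw [erase_inter, inter_erase, erase_idem]
    by_cases hi : x ∈ Z i <;> by_cases hj : x ∈ Z j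
    · have := card_erase_add_one (mem_inter.2 ⟨hi, hj⟩)
      simp only [hi, hj, if_true]
      omega
    all_goals
      rw [erase_eq_of_notMem (by simp [hi, hj])]
      simp only [hi, hj, if_true, if_false]
      omega
  · have := hkr i
    split_ifs <;> omega
  · have h1 (i : ι) : (r - k i) =
        (r - 1 - if x ∈ Z i then k i - 1 else k i) + if x ∉ Z i then 1 else 0 := by
      have := hkr i
      have := hk0 i
      by_cases hi : x ∈ Z i <;> simp [hi] <;> omega
    rw [sum_congr rfl fun i _ ↦ h1 i, sum_add_distrib, ← card_filter, hout x hx] at hsum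
    omega
  · rw [mem_erase] at hy
    rw [← hin y hy.2]
    exact card_le_card fun i ↦ by simp [hy.1]

end Transversal

/-! ### Cotransversal matroids are gammoids -/

section Map

variable {α β : Type*} {M N : Matroid α} {f : α → β}

lemma map_delete (hf : Set.InjOn f M.E) {D : Set α} (hD : D ⊆ M.E) :
    (M ＼ D).map f (hf.mono (M.delete_subset_ground D)) = M.map f hf ＼ (f '' D) := by
  refine ext_indep (by simp [hf.image_sdiff_subset hD]) fun I _ ↦ ?_
  simp only [map_indep_iff, delete_indep_iff]
  have hdisj {I : Set α} (hI : I ⊆ M.E) : Disjoint (f '' I) (f '' D) ↔ Disjoint I D := by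
    rw [Set.disjoint_iff_inter_eq_empty, ← hf.image_inter hI hD, Set.image_eq_empty,
      Set.disjoint_iff_inter_eq_empty]
  constructor
  · rintro ⟨I, ⟨hI, hID⟩, rfl⟩
    exact ⟨⟨I, hI, rfl⟩, (hdisj hI.subset_ground).2 hID⟩
  · rintro ⟨⟨I, hI, rfl⟩, hID⟩
    exact ⟨I, ⟨hI, (hdisj hI.subset_ground).1 hID⟩, rfl⟩

lemma map_contract (hf : Set.InjOn f M.E) {C : Set α} (hC : C ⊆ M.E) :
    (M ／ C).map f (hf.mono (M.contract_ground_subset_ground C)) = M.map f hf ／ (f '' C) := by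
  have hf' : Set.InjOn f M✶.E := hf
  calc
    _ = ((M✶ ＼ C).map f (hf'.mono (M✶.delete_subset_ground C)))✶ := map_dual.symm
    _ = (M✶.map f hf' ＼ (f '' C))✶ := by rw [map_delete hf' hC]
    _ = ((M.map f hf)✶ ＼ (f '' C))✶ := by rw [map_dual]
    _ = _ := rfl

lemma IsMinor.map (h : N ≤m M) (hf : Set.InjOn f M.E) :
    N.map f (hf.mono h.subset) ≤m M.map f hf := by
  obtain ⟨C, D, hC, hD, hCD, rfl⟩ := h.exists_eq_contract_delete_disjoint
  refine ⟨f '' C, f '' D, ?_⟩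
  rw [map_delete (M := M ／ C) (hf.mono (M.contract_ground_subset_ground C))
    (Set.subset_sdiff.2 ⟨hD, hCD.symm⟩), map_contract hf hC]

end Map

section Gammoid

variable {α : Type u} {M N : Matroid α}

lemma isGammoid_of_isMinor_isTransversal (hM : M.IsTransversal) (h : N ≤m M) : N.IsGammoid :=
  ⟨α, M, id, Set.injOn_id _, hM, by rwa [map_id]⟩

/-- Let `M✶` be presented by a family `W` of `n` subsets of `E`. Match `E` and `n` new elements to
the index set `E`, each `e ∈ E` to itself only and the new element `j` to the members of `W j`. The
bases of this transversal matroid are the matched sets of size `|E|`, and contracting the new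
elements leaves `M`. The new elements make the larger type `α ⊕ ULift (Fin n)` necessary. -/
theorem IsCotransversal.exists_isMinor_isTransversal (hM : M.IsCotransversal) :
    ∃ (n : ℕ) (Q : Matroid (α ⊕ ULift.{u} (Fin n))),
      Q.IsTransversal ∧ M.map Sum.inl Sum.inl_injective.injOn ≤m Q := by
  classical
  obtain ⟨hfin, n, W, -, hind⟩ := hM
  rw [dual_ground] at hfin hind
  lift M.E to Finset α using hfin with E hE
  let t : α ⊕ ULift.{u} (Fin n) → Finset α := Sum.elim (fun e ↦ {e}) fun j ↦ {e ∈ E | e ∈ W j.down}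
  let G : Finset (α ⊕ ULift.{u} (Fin n)) := E.disjSum univ
  obtain ⟨Q, hQE, hQ⟩ := exists_indep_iff_hallCondition G t
  have htE : ∀ x ∈ G, t x ⊆ E := by
    rintro (e | j) hx
    · simpa [t, G] using hx
    · exact filter_subset _ _
  refine ⟨n, Q, isTransversal_of_hallCondition hQE t E htE hQ, Set.range Sum.inr, ∅, ?_⟩
  have hinj : Set.InjOn (Sum.inl : α → α ⊕ ULift.{u} (Fin n)) M✶.E := Sum.inl_injective.injOn
  have hmap : (M.map Sum.inl Sum.inl_injective.injOn)✶ =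
    M✶.map (Sum.inl : α → α ⊕ ULift.{u} (Fin n)) hinj := map_dual
  -- On the dual side, the new elements are deleted from `Q✶`.
  rw [delete_empty, ← dual_inj, dual_contract, hmap]
  have hcoe {X : Set (α ⊕ ULift.{u} (Fin n))} (hX : X ⊆ Q.E) :
      ∃ Y : Finset (α ⊕ ULift.{u} (Fin n)), (Y : Set _) = X ∧ Y ⊆ G := by
    rw [hQE] at hX
    lift X to Finset (α ⊕ ULift.{u} (Fin n)) using G.finite_toSet.subset hX
    exact ⟨X, rfl, by simpa using hX⟩
  have hQcard {X : Finset (α ⊕ ULift.{u} (Fin n))} (hX : Q.Indep X) : #X ≤ #E := by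
    rw [hQ] at hX
    exact (hX.2 X subset_rfl).trans (card_le_card (biUnion_subset.2 fun x hx ↦ htE x (hX.1 hx)))
  have hbase {X : Finset (α ⊕ ULift.{u} (Fin n))} (hX : Q.Indep X) (hXc : #X = #E) :
      Q.IsBase X := by
    rw [isBase_iff_maximal_indep, maximal_subset_iff]
    refine ⟨hX, fun Y hY hXY ↦ ?_⟩
    obtain ⟨Y, rfl, -⟩ := hcoe hY.subset_ground
    rw [coe_inj]
    exact eq_of_subset_of_card_le (coe_subset.1 hXY) ((hQcard hY).trans hXc.ge)
  -- A matching of `I` into `W` completes `E \ I` to a base of `Q` that consists of `E \ I` and of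
  -- the new elements used.
  have hmatch (I : Finset α) (hIE : I ⊆ E) (φ : ↥(I : Set α) → Fin n) (hφ : Function.Injective φ)
      (hφW : ∀ x, (x : α) ∈ W (φ x)) :
      Q.IsBase ((E \ I).disjSum (univ.image fun x ↦ ULift.up (φ x)) : Finset _) := by
    refine hbase ((hQ _).2 ⟨disjSum_mono sdiff_subset (subset_univ _), ?_⟩) ?_
    · rw [hallCondition_iff_exists_injective]
      have hex (b : (((E \ I).disjSum (univ.image fun x ↦ ULift.up (φ x)) : Finset _) :
          Set (α ⊕ ULift.{u} (Fin n)))) :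
          ∃ y, (y ∉ I ∧ y ∈ E ∧ b.1 = Sum.inl y) ∨
            ∃ h : y ∈ (I : Set α), b.1 = Sum.inr ⟨φ ⟨y, h⟩⟩ := by
        obtain ⟨e | j, hb⟩ := b
        · exact ⟨e, .inl (by simpa [and_comm] using hb)⟩
        · obtain ⟨y, hy, rfl⟩ : ∃ y, ∃ h : y ∈ I, ULift.up (φ ⟨y, h⟩) = j := by simpa using hb
          exact ⟨y, .inr ⟨hy, rfl⟩⟩
      choose g hg using hex
      refine ⟨g, fun b c hbc ↦ ?_, fun b ↦ ?_⟩
      · have hb := hg b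
        have hc := hg c
        rw [hbc] at hb
        rcases hb with ⟨h1, -, hb⟩ | ⟨h1, hb⟩ <;> rcases hc with ⟨h2, -, hc⟩ | ⟨h2, hc⟩
        · exact Subtype.ext (hb.trans hc.symm)
        · exact absurd h2 h1
        · exact absurd h1 h2
        · exact Subtype.ext (hb.trans hc.symm)
      · rcases hg b with ⟨-, -, hb⟩ | ⟨h, hb⟩
        · simp [t, hb]
        · simpa [t, hb] using ⟨hIE h, hφW ⟨_, h⟩⟩
    · rw [card_disjSum, card_image_of_injective _ fun x y hxy ↦ hφ (ULift.up_injective hxy),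
        card_univ, ← card_sdiff_add_card_eq_card hIE]
      simp
  -- The matching of `∅` shows that `E` itself is a base, so all bases have `|E|` elements.
  have hinl := hmatch ∅ (empty_subset _) (fun x ↦ (by simpa using x.2 : False).elim)
    (fun x ↦ (by simpa using x.2 : False).elim) (fun x ↦ (by simpa using x.2 : False).elim)
  have hQbase {X : Finset (α ⊕ ULift.{u} (Fin n))} (hX : Q.IsBase X) : #X = #E := by
    have := hX.encard_eq_encard_of_isBase hinl
    rw [Set.encard_coe_eq_coe_finsetCard, Set.encard_coe_eq_coe_finsetCard, Nat.cast_inj] at this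
    simpa using this
  refine ext_indep ?_ fun I hI ↦ ?_
  · ext x
    rcases x with x | x <;> simp [hQE, G, ← hE]
  obtain ⟨I, hIE, rfl⟩ : ∃ I₀ : Set α, I₀ ⊆ E ∧ I = Sum.inl '' I₀ := by
    rw [map_ground, dual_ground, ← hE, Set.subset_image_iff] at hI
    obtain ⟨I₀, hI₀, rfl⟩ := hI
    exact ⟨I₀, hI₀, rfl⟩
  lift I to Finset α using E.finite_toSet.subset hIE
  have hIQ : Sum.inl '' (I : Set α) ⊆ Q.E := by
    rw [hQE]
    rintro _ ⟨x, hx, rfl⟩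
    simpa [G] using hIE hx
  rw [map_image_indep_iff (by rwa [dual_ground, ← hE]), hind, and_iff_right hIE, delete_indep_iff,
    dual_indep_iff_exists hIQ,
    and_iff_left (by rw [Set.disjoint_left]; rintro _ ⟨x, -, rfl⟩; simp)]
  constructor
  · rintro ⟨φ, hφ, hφW⟩
    refine ⟨_, hmatch I hIE φ hφ hφW, ?_⟩
    rw [Set.disjoint_left]
    rintro _ ⟨x, hx, rfl⟩
    simpa using fun _ ↦ hx
  · rintro ⟨B, hB, hIB⟩
    obtain ⟨B, rfl, hBG⟩ := hcoe hB.subset_ground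
    obtain ⟨ψ, hψ, hψt⟩ := (hallCondition_iff_exists_injective t B).1 ((hQ B).1 hB.indep).2
    -- A base disjoint from `I` is matched onto `E`, and `I` can only be matched by new elements.
    have himg : univ.image ψ = E := by
      refine eq_of_subset_of_card_le (fun y hy ↦ ?_) ?_
      · obtain ⟨b, -, rfl⟩ := mem_image.1 hy
        exact htE b (hBG b.2) (hψt b)
      · rw [card_image_of_injective _ hψ, ← hQbase hB]
        simp
    have hex (x : (I : Set α)) : ∃ j : Fin n,
        ∃ h : Sum.inr (ULift.up j) ∈ (B : Set (α ⊕ ULift.{u} (Fin n))), ψ ⟨_, h⟩ = x := by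
      obtain ⟨⟨e | j, hb⟩, -, hbx⟩ := mem_image.1 (himg.ge (hIE x.2))
      · have hbt := hψt ⟨_, hb⟩
        rw [hbx] at hbt
        have : (x : α) = e := by simpa [t] using hbt
        exact absurd hb (Set.disjoint_left.1 hIB ⟨x, x.2, by rw [this]⟩)
      · exact ⟨j.down, hb, hbx⟩
    choose g hgB hg using hex
    refine ⟨g, fun x y hxy ↦ ?_, fun x ↦ ?_⟩
    · apply Subtype.ext
      rw [← hg x, ← hg y]
      congr 3
      rw [hxy]
    · have := hψt ⟨_, hgB x⟩
      rw [hg x] at this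
      simpa [t] using (mem_filter.1 this).2

theorem isGammoid_of_isMinor_isCotransversal (hM : M.IsCotransversal) (h : N ≤m M) :
    N.IsGammoid := by
  obtain ⟨n, Q, hQ, hMQ⟩ := hM.exists_isMinor_isTransversal
  exact ⟨_, Q, Sum.inl, Sum.inl_injective.injOn, hQ, (h.map Sum.inl_injective.injOn).trans hMQ⟩

end Gammoid

/-! ### The matroids of six-tuples -/

section Alpha

variable {α : Type u} {r : ℕ} {A B C D E F : Finset α} {M : Matroid α}

/-- The conditions on a six-tuple of pairwise disjoint nonempty sets of finite size. The sizes of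
the unions are written as sums. -/
structure IsAlphaTuple (r : ℕ) (A B C D E F : Finset α) : Prop where
  pos : 0 < #A ∧ 0 < #B ∧ 0 < #C ∧ 0 < #D ∧ 0 < #E ∧ 0 < #F
  disjoint : [A, B, C, D, E, F].Pairwise Disjoint
  card_ABC : #A + #B + #C = r
  card_DEF : #D + #E + #F = r
  card_ABDE : #A + #B + #D + #E = r + 1

/-- The ranks of the four sets `alphaFlat A B C D E F i`. -/
def alphaRank (A B C D E F : Finset α) : Fin 4 → ℕ := ![#C + #B, #C + #A, #F + #E, #F + #D]

namespace IsAlphaTuple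

lemma disjoints (h : IsAlphaTuple r A B C D E F) :
    Disjoint A B ∧ Disjoint A C ∧ Disjoint A D ∧ Disjoint A E ∧ Disjoint A F ∧ Disjoint B C ∧
    Disjoint B D ∧ Disjoint B E ∧ Disjoint B F ∧ Disjoint C D ∧ Disjoint C E ∧ Disjoint C F ∧
    Disjoint D E ∧ Disjoint D F ∧ Disjoint E F := by
  have := h.disjoint
  simp only [List.pairwise_cons, List.mem_cons, List.not_mem_nil, or_false, forall_eq_or_imp,
    forall_eq, List.Pairwise.nil, and_true, IsEmpty.forall_iff, implies_true] at this
  tauto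

lemma notMem (h : IsAlphaTuple r A B C D E F) : (∀ x ∈ A, x ∉ B ∧ x ∉ C ∧ x ∉ D ∧ x ∉ E ∧ x ∉ F) ∧
    (∀ x ∈ B, x ∉ A ∧ x ∉ C ∧ x ∉ D ∧ x ∉ E ∧ x ∉ F) ∧
    (∀ x ∈ C, x ∉ A ∧ x ∉ B ∧ x ∉ D ∧ x ∉ E ∧ x ∉ F) ∧
    (∀ x ∈ D, x ∉ A ∧ x ∉ B ∧ x ∉ C ∧ x ∉ E ∧ x ∉ F) ∧
    (∀ x ∈ E, x ∉ A ∧ x ∉ B ∧ x ∉ C ∧ x ∉ D ∧ x ∉ F) ∧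
    (∀ x ∈ F, x ∉ A ∧ x ∉ B ∧ x ∉ C ∧ x ∉ D ∧ x ∉ E) := by
  have := h.disjoints
  simp only [Finset.disjoint_left] at this
  refine ⟨?_, ?_, ?_, ?_, ?_, ?_⟩ <;> intro x hx <;> grind

lemma alphaRank_pos (h : IsAlphaTuple r A B C D E F) (i : Fin 4) : 0 < alphaRank A B C D E F i := by
  obtain ⟨pA, pB, pC, pD, pE, pF⟩ := h.pos
  fin_cases i <;> change 0 < #_ + #_ <;> omega

lemma alphaRank_lt (h : IsAlphaTuple r A B C D E F) (i : Fin 4) : alphaRank A B C D E F i < r := by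
  obtain ⟨pA, pB, pC, pD, pE, pF⟩ := h.pos
  have h1 := h.card_ABC
  have h2 := h.card_DEF
  fin_cases i <;> simp [alphaRank] <;> omega

end IsAlphaTuple

variable [DecidableEq α]

/-- The ground set of the matroid of a six-tuple. -/
def alphaGround (A B C D E F : Finset α) : Finset α := A ∪ B ∪ C ∪ D ∪ E ∪ F

/-- The four proper nonempty cyclic flats of the matroid of a six-tuple. -/
def alphaFlat (A B C D E F : Finset α) : Fin 4 → Finset α :=
  ![C ∪ B ∪ E, C ∪ A ∪ D, F ∪ E ∪ A, F ∪ D ∪ B]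

lemma alphaFlat_subset (i : Fin 4) : alphaFlat A B C D E F i ⊆ alphaGround A B C D E F := by
  unfold alphaGround
  fin_cases i
  · change C ∪ B ∪ E ⊆ _
    intro x
    simp only [mem_union]
    tauto
  · change C ∪ A ∪ D ⊆ _
    intro x
    simp only [mem_union]
    tauto
  · change F ∪ E ∪ A ⊆ _
    intro x
    simp only [mem_union]
    tauto
  · change F ∪ D ∪ B ⊆ _
    intro x
    simp only [mem_union]
    tauto

namespace IsAlphaTuple

/-- The four cyclic flats meet pairwise in the six sets of the tuple, one for each pair. -/
lemma add_card_inter_le (h : IsAlphaTuple r A B C D E F) (i j : Fin 4) (hij : i ≠ j) :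
    r + #(alphaFlat A B C D E F i ∩ alphaFlat A B C D E F j) ≤
      alphaRank A B C D E F i + alphaRank A B C D E F j := by
  obtain ⟨hA, hB, hC, hD, hE, hF⟩ := h.notMem
  obtain ⟨pA, pB, pC, pD, pE, pF⟩ := h.pos
  have h1 := h.card_ABC
  have h2 := h.card_DEF
  have h3 := h.card_ABDE
  have e01 : (C ∪ B ∪ E) ∩ (C ∪ A ∪ D) = C := by grind
  have e02 : (C ∪ B ∪ E) ∩ (F ∪ E ∪ A) = E := by grind
  have e03 : (C ∪ B ∪ E) ∩ (F ∪ D ∪ B) = B := by grind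
  have e12 : (C ∪ A ∪ D) ∩ (F ∪ E ∪ A) = A := by grind
  have e13 : (C ∪ A ∪ D) ∩ (F ∪ D ∪ B) = D := by grind
  have e23 : (F ∪ E ∪ A) ∩ (F ∪ D ∪ B) = F := by grind
  have hle {P Q W : Finset α} {m : ℕ} (hPQ : P ∩ Q = W ∨ Q ∩ P = W) (hm : r + #W ≤ m) :
      r + #(P ∩ Q) ≤ m := by
    rcases hPQ with rfl | rfl
    · exact hm
    · rwa [inter_comm]
  fin_cases i <;> fin_cases j
  · exact absurd rfl hij
  · exact hle (.inl e01) (by simp [alphaRank]; omega)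
  · exact hle (.inl e02) (by simp [alphaRank]; omega)
  · exact hle (.inl e03) (by simp [alphaRank]; omega)
  · exact hle (.inr e01) (by simp [alphaRank]; omega)
  · exact absurd rfl hij
  · exact hle (.inl e12) (by simp [alphaRank]; omega)
  · exact hle (.inl e13) (by simp [alphaRank]; omega)
  · exact hle (.inr e02) (by simp [alphaRank]; omega)
  · exact hle (.inr e12) (by simp [alphaRank]; omega)
  · exact absurd rfl hij
  · exact hle (.inl e23) (by simp [alphaRank]; omega)
  · exact hle (.inr e03) (by simp [alphaRank]; omega)
  · exact hle (.inr e13) (by simp [alphaRank]; omega)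
  · exact hle (.inr e23) (by simp [alphaRank]; omega)
  · exact absurd rfl hij

lemma card_alphaFlat (h : IsAlphaTuple r A B C D E F) (i : Fin 4) :
    #(alphaFlat A B C D E F i) = ![#C + #B + #E, #C + #A + #D, #F + #E + #A, #F + #D + #B] i := by
  obtain ⟨hA, hB, hC, hD, hE, hF⟩ := h.notMem
  fin_cases i
  all_goals
    change #(_ ∪ _ ∪ _) = _ + _ + _
    rw [card_union_of_disjoint, card_union_of_disjoint]
    all_goals rw [Finset.disjoint_left]; grind

lemma card_ground (h : IsAlphaTuple r A B C D E F) : #(alphaGround A B C D E F) = r + r := by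
  obtain ⟨hA, hB, hC, hD, hE, hF⟩ := h.notMem
  have h1 := h.card_ABC
  have h2 := h.card_DEF
  rw [alphaGround, card_union_of_disjoint, card_union_of_disjoint, card_union_of_disjoint,
    card_union_of_disjoint, card_union_of_disjoint]
  · omega
  all_goals rw [Finset.disjoint_left]; grind

lemma alphaRank_lt_card (h : IsAlphaTuple r A B C D E F) (i : Fin 4) :
    alphaRank A B C D E F i < #(alphaFlat A B C D E F i) := by
  obtain ⟨pA, pB, pC, pD, pE, pF⟩ := h.pos
  rw [h.card_alphaFlat]
  fin_cases i <;> change #_ + #_ < #_ + #_ + #_ <;> omega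

lemma card_filter_mem (h : IsAlphaTuple r A B C D E F) {x : α} (hx : x ∈ alphaGround A B C D E F) :
    #{i | x ∈ alphaFlat A B C D E F i} = 2 := by
  obtain ⟨hA, hB, hC, hD, hE, hF⟩ := h.notMem
  simp only [alphaGround, mem_union] at hx
  rw [card_filter, Fin.sum_univ_four]
  simp only [alphaFlat, Matrix.cons_val, mem_union]
  rcases hx with ((((hx | hx) | hx) | hx) | hx) | hx
  · simp [hx, hA x hx]
  · simp [hx, hB x hx]
  · simp [hx, hC x hx]
  · simp [hx, hD x hx]
  · simp [hx, hE x hx]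
  · simp [hx, hF x hx]

lemma card_filter_notMem (h : IsAlphaTuple r A B C D E F) {x : α}
    (hx : x ∈ alphaGround A B C D E F) :
    #{i | x ∉ alphaFlat A B C D E F i} = 2 := by
  have h1 := h.card_filter_mem hx
  have h2 := card_filter_add_card_filter_not (s := (univ : Finset (Fin 4)))
    (fun i ↦ x ∈ alphaFlat A B C D E F i)
  rw [h1, card_univ, Fintype.card_fin] at h2
  omega

lemma splitIndep_ABC (h : IsAlphaTuple r A B C D E F) :
    SplitIndep (alphaGround A B C D E F) r (alphaFlat A B C D E F) (alphaRank A B C D E F)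
      (A ∪ B ∪ C) ∧ #(A ∪ B ∪ C) = r := by
  obtain ⟨hA, hB, hC, hD, hE, hF⟩ := h.notMem
  obtain ⟨pA, pB, pC, pD, pE, pF⟩ := h.pos
  have h1 := h.card_ABC
  have h2 := h.card_DEF
  have h3 := h.card_ABDE
  have hc : #(A ∪ B ∪ C) = r := by
    rw [← h1, card_union_of_disjoint, card_union_of_disjoint]
    all_goals rw [Finset.disjoint_left]; grind
  refine ⟨⟨by unfold alphaGround; grind, hc.le, fun i ↦ ?_⟩, hc⟩
  fin_cases i
  · exact (card_le_card (t := C ∪ B)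
      (by change (A ∪ B ∪ C) ∩ (C ∪ B ∪ E) ⊆ _; grind)).trans (card_union_le _ _)
  · exact (card_le_card (t := C ∪ A)
      (by change (A ∪ B ∪ C) ∩ (C ∪ A ∪ D) ⊆ _; grind)).trans (card_union_le _ _)
  · refine (card_le_card (t := A) (by change (A ∪ B ∪ C) ∩ (F ∪ E ∪ A) ⊆ _; grind)).trans ?_
    simp [alphaRank]; omega
  · refine (card_le_card (t := B) (by change (A ∪ B ∪ C) ∩ (F ∪ D ∪ B) ⊆ _; grind)).trans ?_
    simp [alphaRank]; omega

lemma splitIndep_DEF (h : IsAlphaTuple r A B C D E F) :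
    SplitIndep (alphaGround A B C D E F) r (alphaFlat A B C D E F) (alphaRank A B C D E F)
      (D ∪ E ∪ F) ∧ #(D ∪ E ∪ F) = r := by
  obtain ⟨hA, hB, hC, hD, hE, hF⟩ := h.notMem
  obtain ⟨pA, pB, pC, pD, pE, pF⟩ := h.pos
  have h1 := h.card_ABC
  have h2 := h.card_DEF
  have h3 := h.card_ABDE
  have hc : #(D ∪ E ∪ F) = r := by
    rw [← h2, card_union_of_disjoint, card_union_of_disjoint]
    all_goals rw [Finset.disjoint_left]; grind
  refine ⟨⟨by unfold alphaGround; grind, hc.le, fun i ↦ ?_⟩, hc⟩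
  fin_cases i
  · refine (card_le_card (t := E) (by change (D ∪ E ∪ F) ∩ (C ∪ B ∪ E) ⊆ _; grind)).trans ?_
    simp [alphaRank]; omega
  · refine (card_le_card (t := D) (by change (D ∪ E ∪ F) ∩ (C ∪ A ∪ D) ⊆ _; grind)).trans ?_
    simp [alphaRank]; omega
  · exact (card_le_card (t := F ∪ E)
      (by change (D ∪ E ∪ F) ∩ (F ∪ E ∪ A) ⊆ _; grind)).trans (card_union_le _ _)
  · exact (card_le_card (t := F ∪ D)
      (by change (D ∪ E ∪ F) ∩ (F ∪ D ∪ B) ⊆ _; grind)).trans (card_union_le _ _)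

/-- The prescribed cyclic flats and ranks describe the same matroid as the bounds on independent
sets. -/
lemma isMAlpha_iff (h : IsAlphaTuple r A B C D E F) : M.IsMAlpha (A : Set α) B C D E F ↔
    M.IsElementarySplit (alphaGround A B C D E F) r (alphaFlat A B C D E F)
      (alphaRank A B C D E F) := by
  have hr : ((A : Set α) ∪ B ∪ C).encard = r := by
    rw [← coe_union, ← coe_union, Set.encard_coe_eq_coe_finsetCard, h.splitIndep_ABC.2]
  constructor
  · intro hM
    have hE : M.E = alphaGround A B C D E F := by
      rw [hM.ground_eq, alphaGround]
      push_cast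
      rfl
    have : M.Finite := ⟨by rw [hE]; exact finite_toSet _⟩
    refine ⟨hE, fun I ↦ ?_⟩
    rw [indep_iff_forall_isCyclicFlat]
    have hEr : M.eRk M.E = r := by rw [eRk_ground, hM.eRank_eq, hr]
    have hinter (X : Finset α) : ((I : Set α) ∩ X).encard = #(I ∩ X) := by
      rw [← coe_inter, Set.encard_coe_eq_coe_finsetCard]
    have h0 := hM.eRk_CBE
    have h1 := hM.eRk_CAD
    have h2 := hM.eRk_FEA
    have h3 := hM.eRk_FDB
    simp only [← coe_union, Set.encard_coe_eq_coe_finsetCard, ← Nat.cast_add] at h0 h1 h2 h3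
    simp only [hM.isCyclicFlat_iff, forall_eq_or_imp, forall_eq, ← coe_union, hinter, h0, h1, h2,
      h3, Set.inter_empty, Set.encard_empty, zero_le, true_and, Nat.cast_le, SplitIndep,
      Fin.forall_fin_succ, IsEmpty.forall_iff, and_true, alphaFlat, alphaRank, hE, coe_subset]
    rw [hE] at hEr
    constructor
    · rintro ⟨hI, h0, h1, h2, h3, h4⟩
      rw [inter_eq_left.2 hI, hEr, Nat.cast_le] at h4
      exact ⟨hI, h4, h0, h1, h2, h3⟩
    · rintro ⟨hI, h4, h0, h1, h2, h3⟩
      rw [inter_eq_left.2 hI, hEr, Nat.cast_le]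
      exact ⟨hI, h0, h1, h2, h3, h4⟩
  · intro hM
    have heRk (i : Fin 4) := hM.eRk_eq h.add_card_inter_le alphaFlat_subset h.alphaRank_lt
      h.alphaRank_lt_card i
    have hE : M.E = alphaGround A B C D E F := hM.ground_eq
    refine ⟨?_, fun X ↦ ?_, ?_, ?_, ?_, ?_, ?_⟩
    · rw [hE, alphaGround]
      push_cast
      rfl
    · rw [hM.isCyclicFlat_iff h.add_card_inter_le alphaFlat_subset h.alphaRank_pos h.alphaRank_lt
        h.alphaRank_lt_card (by have := h.card_ABC; have := h.pos; omega) (fun x hx ↦ ?_), hE]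
      · simp [alphaFlat, Fin.exists_fin_succ, Set.union_assoc, or_assoc]
      · have := h.card_filter_mem hx
        obtain ⟨i, hi⟩ := card_pos.1 (this ▸ two_pos)
        exact ⟨i, by simpa using hi⟩
    · rw [hr, hM.eRank_eq ⟨_, h.splitIndep_ABC⟩]
    · simpa [alphaFlat, alphaRank, Set.union_assoc] using heRk 0
    · simpa [alphaFlat, alphaRank, Set.union_assoc] using heRk 1
    · simpa [alphaFlat, alphaRank, Set.union_assoc] using heRk 2
    · simpa [alphaFlat, alphaRank, Set.union_assoc] using heRk 3

/-- An exchange bijection from the base `A ∪ B ∪ C` to the base `D ∪ E ∪ F` would map `A ∪ B` into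
`F`, but `|A| + |B| = |F| + 1`. -/
lemma not_isBaseOrderable (h : IsAlphaTuple r A B C D E F)
    (hM : M.IsElementarySplit (alphaGround A B C D E F) r (alphaFlat A B C D E F)
      (alphaRank A B C D E F)) : ¬ M.IsBaseOrderable := by
  intro hBO
  have hB := hM.isBase_iff ⟨_, h.splitIndep_ABC⟩ (I := A ∪ B ∪ C)
  have hB' := hM.isBase_iff ⟨_, h.splitIndep_ABC⟩ (I := D ∪ E ∪ F)
  obtain ⟨σ, hσ, hσx⟩ := hBO _ _ (hB.2 h.splitIndep_ABC) (hB'.2 h.splitIndep_DEF)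
  obtain ⟨hA, hB, hC, hD, hE, hF⟩ := h.notMem
  have hle {X : Finset α} (hX : M.IsBase X) (i : Fin 4) {Y : Finset α} {x : α} (hx : x ∉ Y)
      (hxX : x ∈ X) (hY : Y ⊆ X) (hxZ : insert x Y ⊆ alphaFlat A B C D E F i) :
      #Y < alphaRank A B C D E F i := by
    have h1 := ((hM.indep_iff X).1 hX.indep).2.2 i
    have h2 : #(insert x Y) ≤ #(X ∩ alphaFlat A B C D E F i) :=
      card_le_card (subset_inter (insert_subset hxX hY) hxZ)
    rw [card_insert_of_notMem hx] at h2
    omega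
  have hAB : #(A ∪ B) = #A + #B :=
    card_union_of_disjoint (by rw [Finset.disjoint_left]; intro x hx; exact (hA x hx).1)
  have hFE : #(F ∪ E) = #F + #E :=
    card_union_of_disjoint (by rw [Finset.disjoint_left]; intro x hx; grind)
  have hCB : #(C ∪ B) = #C + #B :=
    card_union_of_disjoint (by rw [Finset.disjoint_left]; intro x hx; grind)
  have hCA : #(C ∪ A) = #C + #A :=
    card_union_of_disjoint (by rw [Finset.disjoint_left]; intro x hx; grind)
  have hFD : #(F ∪ D) = #F + #D :=
    card_union_of_disjoint (by rw [Finset.disjoint_left]; intro x hx; grind)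
  -- An exchange of an element of `A ∪ B` with one of `D ∪ E` would put one element too many into a
  -- cyclic flat: `x` and `F ∪ E` into the third, `σ x` and `C ∪ B` into the first, and so on.
  have hmaps : ∀ x ∈ A ∪ B, σ x ∈ F := by
    intro x hx
    have hx' : x ∈ A ∪ B ∪ C := by grind
    have hσxm : σ x ∈ D ∪ E ∪ F := by exact_mod_cast hσ.mapsTo (mem_coe.2 hx')
    obtain ⟨h1, h2⟩ := hσx x (mem_coe.2 hx')
    have e1 : ((A ∪ B ∪ C : Finset α) : Set α) \ {x} ∪ {σ x} =
        ((insert (σ x) ((A ∪ B ∪ C).erase x) : Finset α) : Set α) := by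
      push_cast; rw [Set.union_singleton]
    have e2 : ((D ∪ E ∪ F : Finset α) : Set α) \ {σ x} ∪ {x} =
        ((insert x ((D ∪ E ∪ F).erase (σ x)) : Finset α) : Set α) := by
      push_cast; rw [Set.union_singleton]
    rw [e1] at h1
    rw [e2] at h2
    by_contra hxF
    rw [mem_union] at hx
    have hDE : σ x ∈ D ∨ σ x ∈ E := by simpa [hxF] using hσxm
    clear hσ hσx e1 e2
    generalize σ x = y at *
    rcases hx with hx | hx <;> rcases hDE with hy | hy
    · have := hle h2 2 (x := x) (Y := F ∪ E) (by grind) (by simp)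
        (by intro z hz; clear h1 h2 hle; grind) 
        (by change insert x (F ∪ E) ⊆ F ∪ E ∪ A; clear h1 h2 hle; grind)
      rw [hFE] at this
      exact lt_irrefl _ this
    · have := hle h1 0 (x := y) (Y := C ∪ B) (by grind) (by simp)
        (by intro z hz; clear h1 h2 hle; grind) 
        (by change insert y (C ∪ B) ⊆ C ∪ B ∪ E; clear h1 h2 hle; grind)
      rw [hCB] at this
      exact lt_irrefl _ this
    · have := hle h1 1 (x := y) (Y := C ∪ A) (by grind) (by simp)
        (by intro z hz; clear h1 h2 hle; grind) 
        (by change insert y (C ∪ A) ⊆ C ∪ A ∪ D; clear h1 h2 hle; grind)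
      rw [hCA] at this
      exact lt_irrefl _ this
    · have := hle h2 3 (x := x) (Y := F ∪ D) (by grind) (by simp)
        (by intro z hz; clear h1 h2 hle; grind) 
        (by change insert x (F ∪ D) ⊆ F ∪ D ∪ B; clear h1 h2 hle; grind)
      rw [hFD] at this
      exact lt_irrefl _ this
  have hcard := card_le_card_of_injOn σ hmaps
    (hσ.injOn.mono (by push_cast; exact Set.subset_union_left))
  rw [hAB] at hcard
  have h1 := h.card_ABC
  have h2 := h.card_DEF
  have h3 := h.card_ABDE
  omega

lemma isTransversal_contract (h : IsAlphaTuple r A B C D E F)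
    (hM : M.IsElementarySplit (alphaGround A B C D E F) r (alphaFlat A B C D E F)
      (alphaRank A B C D E F)) {x : α}
    (hx : x ∈ alphaGround A B C D E F) : (M ／ {x}).IsTransversal := by
  have h1 := h.card_ABC
  have h2 := h.card_DEF
  have h3 := h.card_ABDE
  obtain ⟨pA, pB, pC, pD, pE, pF⟩ := h.pos
  refine hM.isTransversal_contract h.add_card_inter_le h.alphaRank_pos h.alphaRank_lt (by omega)
    ?_ (fun x hx ↦ h.card_filter_mem hx) (fun x hx ↦ h.card_filter_notMem hx) hx
  simp [Fin.sum_univ_four, alphaRank]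
  omega

/-- The dual is an elementary split matroid of the same kind, on the complements of the four cyclic
flats, and meets the conditions of `IsElementarySplit.isTransversal_contract` as well. -/
lemma isTransversal_dual_contract (h : IsAlphaTuple r A B C D E F)
    (hM : M.IsElementarySplit (alphaGround A B C D E F) r
      (alphaFlat A B C D E F) (alphaRank A B C D E F)) {x : α}
    (hx : x ∈ alphaGround A B C D E F) : (M✶ ／ {x}).IsTransversal := by
  have h1 := h.card_ABC
  have h2 := h.card_DEF
  have h3 := h.card_ABDE
  obtain ⟨pA, pB, pC, pD, pE, pF⟩ := h.pos
  have hcard (i : Fin 4) : #(alphaGround A B C D E F \ alphaFlat A B C D E F i) +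
      #(alphaFlat A B C D E F i) = r + r := by
    rw [card_sdiff_add_card_eq_card (alphaFlat_subset i), h.card_ground]
  -- The rank of the complement of `Z i` in the dual is `|S \ Z i| + k i - r`.
  have hk' (i : Fin 4) : ![#D + #F, #E + #F, #B + #C, #A + #C] i + r =
      #(alphaGround A B C D E F \ alphaFlat A B C D E F i) + alphaRank A B C D E F i := by
    have := hcard i
    rw [h.card_alphaFlat] at this
    fin_cases i <;> simp [alphaRank] at this ⊢ <;> omega
  have hM' := hM.dual h.add_card_inter_le alphaFlat_subset ⟨_, h.splitIndep_ABC⟩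
    h.card_ground.symm hk'
  refine hM'.isTransversal_contract (fun i j hij ↦ ?_) (fun i ↦ ?_) (fun i ↦ ?_) (by omega) ?_
    (fun x hx ↦ ?_) (fun x hx ↦ ?_) hx
  · exact add_card_sdiff_inter_sdiff_le h.add_card_inter_le alphaFlat_subset h.card_ground.symm
      hk' i j hij
  · fin_cases i <;> change 0 < #_ + #_ <;> omega
  · fin_cases i <;> change #_ + #_ < r <;> omega
  · simp [Fin.sum_univ_four]
    omega
  · simpa [hx] using h.card_filter_notMem hx
  · simpa [hx] using h.card_filter_mem hx

end IsAlphaTuple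

end Alpha

/-! ### Excluded minors -/

section ExcludedMinor

variable {α : Type u} {M N : Matroid α}

lemma exists_isMinor_singleton_of_isStrictMinor (h : N <m M) :
    ∃ x ∈ M.E, N ≤m M ／ {x} ∨ N ≤m M ＼ {x} := by
  obtain ⟨X, Y, hX, hY, -, rfl⟩ := h.1.exists_eq_contract_delete_disjoint
  obtain rfl | ⟨x, hx⟩ := X.eq_empty_or_nonempty
  · obtain rfl | ⟨y, hy⟩ := Y.eq_empty_or_nonempty
    · rw [contract_empty, delete_empty] at h
      exact absurd h (isStrictMinor_irrefl M)
    · refine ⟨y, hY hy, .inr ?_⟩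
      rw [contract_empty, ← Set.union_sdiff_cancel (Set.singleton_subset_iff.2 hy),
        ← delete_delete]
      exact ⟨∅, _, by rw [contract_empty]⟩
  · refine ⟨x, hX hx, .inl ?_⟩
    rw [← Set.union_sdiff_cancel (Set.singleton_subset_iff.2 hx), ← contract_contract]
    exact ⟨_, _, rfl⟩

lemma isGammoid_of_isStrictMinor (hcon : ∀ x ∈ M.E, (M ／ {x}).IsTransversal)
    (hdel : ∀ x ∈ M.E, (M ＼ {x}).IsCotransversal) (h : N <m M) : N.IsGammoid := by
  obtain ⟨x, hx, hN | hN⟩ := exists_isMinor_singleton_of_isStrictMinor h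
  · exact isGammoid_of_isMinor_isTransversal (hcon x hx) hN
  · exact isGammoid_of_isMinor_isCotransversal (hdel x hx) hN

lemma IsAlphaTuple.of_encard [DecidableEq α] {r : ℕ} {A B C D E F : Finset α}
    (hA : A.Nonempty) (hB : B.Nonempty) (hC : C.Nonempty)
    (hD : D.Nonempty) (hE : E.Nonempty) (hF : F.Nonempty)
    (hdisj : [(A : Set α), B, C, D, E, F].Pairwise Disjoint)
    (hABC : ((A : Set α) ∪ B ∪ C).encard = r) (hDEF : ((D : Set α) ∪ E ∪ F).encard = r)
    (hABDE : ((A : Set α) ∪ B ∪ D ∪ E).encard = r + 1) :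
    IsAlphaTuple r A B C D E F := by
  have hd : [A, B, C, D, E, F].Pairwise Disjoint := by
    simpa only [List.pairwise_cons, List.mem_cons, List.not_mem_nil, or_false, forall_eq_or_imp,
      forall_eq, List.Pairwise.nil, and_true, IsEmpty.forall_iff, implies_true,
      disjoint_coe] using hdisj
  have hd' := hd
  simp only [List.pairwise_cons, List.mem_cons, List.not_mem_nil, or_false, forall_eq_or_imp,
    forall_eq, List.Pairwise.nil, and_true, IsEmpty.forall_iff, implies_true] at hd'
  obtain ⟨⟨dAB, dAC, dAD, dAE, dAF⟩, ⟨dBC, dBD, dBE, dBF⟩, ⟨dCD, dCE, dCF⟩, ⟨dDE, dDF⟩, dEF⟩ := hd'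
  refine ⟨⟨hA.card_pos, hB.card_pos, hC.card_pos, hD.card_pos, hE.card_pos, hF.card_pos⟩, hd,
    ?_, ?_, ?_⟩
  · rw [← coe_union, ← coe_union, Set.encard_coe_eq_coe_finsetCard, card_union_of_disjoint,
      card_union_of_disjoint dAB] at hABC
    · exact_mod_cast hABC
    · simp [disjoint_union_left, *]
  · rw [← coe_union, ← coe_union, Set.encard_coe_eq_coe_finsetCard, card_union_of_disjoint,
      card_union_of_disjoint dDE] at hDEF
    · exact_mod_cast hDEF
    · simp [disjoint_union_left, *]
  · rw [← coe_union, ← coe_union, ← coe_union, Set.encard_coe_eq_coe_finsetCard,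
      card_union_of_disjoint, card_union_of_disjoint, card_union_of_disjoint dAB] at hABDE
    · exact_mod_cast hABDE
    all_goals simp [disjoint_union_left, *]

end ExcludedMinor

end Matroid

open Matroid in
theorem mainTheorem2 {α : Type u} (r : ℕ) (hr : 3 ≤ r) (A B C D E F : Set α)
    (hA : A.Nonempty) (hB : B.Nonempty) (hC : C.Nonempty)
    (hD : D.Nonempty) (hE : E.Nonempty) (hF : F.Nonempty)
    (hdisj : [A, B, C, D, E, F].Pairwise Disjoint)
    (hABC : (A ∪ B ∪ C).encard = r) (hDEF : (D ∪ E ∪ F).encard = r)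
    (hABDE : (A ∪ B ∪ D ∪ E).encard = r + 1) :
    (∃! M : Matroid α, M.IsMAlpha A B C D E F) ∧
    ∀ M : Matroid α, M.IsMAlpha A B C D E F →
      ¬ M.IsBaseOrderable ∧
      (∀ x ∈ M.E, (M.contract {x}).IsTransversal) ∧
      (∀ x ∈ M.E, (M.delete {x}).IsCotransversal) ∧
      Matroid.IsExcludedMinor Matroid.IsGammoid M ∧
      Matroid.IsExcludedMinor Matroid.IsBaseOrderable M ∧
      Matroid.IsExcludedMinor Matroid.IsStronglyBaseOrderable M ∧
      ∀ k : ℕ, 1 ≤ k → Matroid.IsExcludedMinor (Matroid.IsKBaseOrderable k) M := by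
  classical
  have hfin1 : (A ∪ B ∪ C).Finite := Set.finite_of_encard_eq_coe hABC
  have hfin2 : (D ∪ E ∪ F).Finite := Set.finite_of_encard_eq_coe hDEF
  lift A to Finset α using hfin1.subset fun x hx ↦ .inl (.inl hx)
  lift B to Finset α using hfin1.subset fun x hx ↦ .inl (.inr hx)
  lift C to Finset α using hfin1.subset fun x hx ↦ .inr hx
  lift D to Finset α using hfin2.subset fun x hx ↦ .inl (.inl hx)
  lift E to Finset α using hfin2.subset fun x hx ↦ .inl (.inr hx)
  lift F to Finset α using hfin2.subset fun x hx ↦ .inr hx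
  have h : IsAlphaTuple r A B C D E F :=
    IsAlphaTuple.of_encard hA hB hC hD hE hF hdisj hABC hDEF hABDE
  simp only [h.isMAlpha_iff]
  refine ⟨?_, fun M hM ↦ ?_⟩
  · obtain ⟨M, hM⟩ := exists_isElementarySplit (alphaGround A B C D E F) r
      (alphaRank A B C D E F) h.add_card_inter_le
    exact ⟨M, hM, fun M' hM' ↦ IsElementarySplit.ext hM' hM⟩
  have hBO := h.not_isBaseOrderable hM
  have hcon : ∀ x ∈ M.E, (M ／ {x}).IsTransversal := fun x hx ↦
    h.isTransversal_contract hM (by simpa [hM.ground_eq] using hx)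
  have hdel : ∀ x ∈ M.E, (M ＼ {x}).IsCotransversal := fun x hx ↦ by
    rw [IsCotransversal, dual_delete]
    exact h.isTransversal_dual_contract hM (by simpa [hM.ground_eq] using hx)
  have hSBO (N : Matroid α) (hN : N <m M) : N.IsStronglyBaseOrderable :=
    (isGammoid_of_isStrictMinor hcon hdel hN).isStronglyBaseOrderable
  exact ⟨hBO, hcon, hdel,
    ⟨fun hG ↦ hBO hG.isStronglyBaseOrderable.isBaseOrderable,
      fun N hN ↦ isGammoid_of_isStrictMinor hcon hdel hN⟩,
    ⟨hBO, fun N hN ↦ (hSBO N hN).isBaseOrderable⟩,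
    ⟨fun hS ↦ hBO hS.isBaseOrderable, hSBO⟩,
    fun k hk ↦ ⟨fun hk' ↦ hBO (hk'.isBaseOrderable hk),
      fun N hN ↦ (hSBO N hN).isKBaseOrderable k⟩⟩
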